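/- **Setting.** Let $N\ge 1$, $\hbar,\theta>0$, $m_1,\dots,m_N>0$, and let $\hat H$ be a self-adjoint operator on $L^2(\mathbb R^N)$ that acts as $\sum_n \hat p_n^2/(2m_n)+U(\hat x)$, with $U:\mathbb R^N\to\mathbb R$, in the sense of distributions. Assume that $\operatorname{Tr}e^{-\hat H/\theta}<\infty$ and let $\hat\rho_\theta=e^{-\hat H/\theta}/\operatorname{Tr}e^{-\hat H/\theta}$ be the thermal state, i.e. $\hat\rho_\theta=\sum_n w_n|\psi_n\rangle\langle\psi_n|$ with an orthonormal basis of eigenvectors $\hat H\psi_n=E_n\psi_n$ and $w_n=e^{-E_n/\theta}/\sum_j e^{-E_j/\theta}$. Let $$W(p,x)=\sum_n w_n\,(2\pi\hbar)^{-N}\int e^{-ip\cdot y/\hbar}\,\psi_n(x+\tfrac y2)\,\overline{\psi_n(x-\tfrac y2)}\,dy$$ be its Wigner function and $B_\theta(p,\lambda)=\int_{\mathbb R^N}e^{i\lambda\cdot x}\,W(p,x)\,dx$ its Blokhintsev function (the integral being absolutely convergent). A translation-invariant Markovian process is the evolution of density operators given by the master equation $$\partial_t\hat\rho=\tfrac i\hbar[\hat\rho,\hat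 H]+\mathcal L_{\rm rel}[\hat\rho],\qquad \mathcal L_{\rm rel}[\hat\rho]=\sum_{k=1}^K\Bigl(\hat A_k\hat\rho\hat A_k^\dagger-\tfrac12\bigl(\hat A_k^\dagger\hat A_k\hat\rho+\hat\rho\hat A_k^\dagger\hat A_k\bigr)\Bigr)-i\,[\kappa_{\rm aux}\cdot\hat x+f_{\rm aux}(\hat p),\hat\rho],$$ $\hat A_k=e^{-i\kappa_k\cdot\hat x}f_k(\hat p)$, with $\kappa_k,\kappa_{\rm aux}\in\mathbb R^N$, $f_k:\mathbb R^N\to\mathbb C$, $f_{\rm aux}:\mathbb R^N\to\mathbb R$. A trajectory is a family $\hat\rho(t)$, $t\ge0$, of density operators that satisfies the equation for the matrix elements $\langle\varphi|\cdot|\psi\rangle$ between all $\varphi,\psi$ in the common domain $D$ of $\hat H$, $\hat A_k^\dagger$, $\hat A_k^\dagger\hat A_k$ and $\kappa_{\rm aux}\cdot\hat x+f_{\rm aux}(\hat p)$. For the expressions to make sense, assume that $f_k\in L^4_{\rm loc}$ and $f_{\rm aux}\in L^2_{\rm loc}$; that the wave functions which are smooth and compactly supported in the momentum representation are limits of elements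 of $D$ in the graph norm of the operators $\hat A_k^\dagger$, $\hat A_k^\dagger\hat A_k$, $\kappa_{\rm aux}\cdot\hat x+f_{\rm aux}(\hat p)$; and that $\operatorname{Tr}(\hat A_k\hat\rho_\theta\hat A_k^\dagger)=\langle|f_k(\hat p)|^2\rangle_\theta<\infty$ for all $k$. **Theorem 2.** Suppose that $$\forall p,\lambda:\ B_\theta(p,\lambda)>0,\quad B_\theta(p,-\lambda)=B_\theta(p,\lambda);\qquad \forall p\ne0,\ \lambda\ne0:\ B_\theta(p,\lambda)<B_\theta(0,0).$$ Then no translation-invariant Markovian process as above can asymptotically steer the system to $\hat\rho_\theta$: if $\mathcal L_{\rm rel}\neq0$, then no trajectory converges to $\hat\rho_\theta$ as $t\to\infty$ (in particular, $\hat\rho_\theta$ is not stationary); and for every $\mathcal L_{\rm rel}$, no trajectory with $\hat\rho(0)\ne\hat\rho_\theta$ converges to $\hat\rho_\theta$. Convergence is understood for all matrix elements, which for density operators is the same as convergence in trace norm. -/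

import Mathlib

open MeasureTheory Filter Set
open scoped Topology FourierTransform ContDiff ComplexOrder LinearPMap

noncomputable section

namespace NoThermalization

/-- Configuration (and momentum) space `ℝ^N` with its Euclidean structure. -/
abbrev Config (N : ℕ) : Type := EuclideanSpace ℝ (Fin N)

/-- The Hilbert space `L²(ℝ^N)` of the system, in the position representation. -/
abbrev Hilb (N : ℕ) : Type := Lp ℂ 2 (volume : Measure (Config N))

variable {N : ℕ}

/-! ## Unbounded operators -/

/-- The value `T x` of a partially defined operator; it is only used for `x` in the domain. -/
def app (T : Hilb N →ₗ.[ℂ] Hilb N) (x : Hilb N) : Hilb N :=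
  open Classical in if h : x ∈ T.domain then T ⟨x, h⟩ else 0

theorem mul_add_ae (g : Config N → ℂ) (a b : Hilb N) :
    (fun x => g x * (a + b : Hilb N) x) =ᵐ[volume]
      (fun x => g x * a x) + fun x => g x * b x := by
  filter_upwards [Lp.coeFn_add a b] with x hx
  rw [hx, Pi.add_apply, Pi.add_apply, mul_add]

theorem mul_smul_ae (g : Config N → ℂ) (c : ℂ) (a : Hilb N) :
    (fun x => g x * (c • a : Hilb N) x) =ᵐ[volume] c • fun x => g x * a x := by
  filter_upwards [Lp.coeFn_smul c a] with x hx
  rw [hx, Pi.smul_apply, Pi.smul_apply, smul_eq_mul, smul_eq_mul, mul_left_comm]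

theorem toLp_mul_add (g : Config N → ℂ) (a b : Hilb N)
    (ha : MemLp (fun x => g x * a x) 2 volume) (hb : MemLp (fun x => g x * b x) 2 volume)
    (h : MemLp (fun x => g x * (a + b : Hilb N) x) 2 volume) :
    h.toLp _ = ha.toLp _ + hb.toLp _ := by
  refine Lp.ext ?_
  filter_upwards [h.coeFn_toLp, Lp.coeFn_add (ha.toLp _) (hb.toLp _), ha.coeFn_toLp,
    hb.coeFn_toLp, mul_add_ae g a b] with x h1 h2 h3 h4 h5
  rw [h1, h5, h2, Pi.add_apply, Pi.add_apply, h3, h4]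

theorem toLp_mul_smul (g : Config N → ℂ) (c : ℂ) (a : Hilb N)
    (h : MemLp (fun x => g x * a x) 2 volume)
    (h' : MemLp (fun x => g x * (c • a : Hilb N) x) 2 volume) :
    h'.toLp _ = c • h.toLp _ := by
  refine Lp.ext ?_
  filter_upwards [h'.coeFn_toLp, Lp.coeFn_smul c (h.toLp _), h.coeFn_toLp, mul_smul_ae g c a]
    with x h1 h2 h3 h4
  rw [h1, h4, h2, Pi.smul_apply, Pi.smul_apply, h3]

/-- The maximal domain `{ψ ∈ L² | g ψ ∈ L²}` of multiplication by `g`. -/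
def mulDomain (g : Config N → ℂ) : Submodule ℂ (Hilb N) where
  carrier := {ψ | MemLp (fun x => g x * ψ x) 2 volume}
  zero_mem' := by
    refine MemLp.ae_eq (f := fun _ => (0 : ℂ)) ?_ MemLp.zero'
    filter_upwards [Lp.coeFn_zero ℂ 2 (volume : Measure (Config N))] with x hx
    rw [hx, Pi.zero_apply, mul_zero]
  add_mem' ha hb := (memLp_congr_ae (mul_add_ae g _ _)).2 (MemLp.add ha hb)
  smul_mem' c _ ha := (memLp_congr_ae (mul_smul_ae g c _)).2 (MemLp.const_smul ha c)

/-- Multiplication by `g`, on its maximal domain. -/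
def mulOp (g : Config N → ℂ) : Hilb N →ₗ.[ℂ] Hilb N where
  domain := mulDomain g
  toFun :=
    { toFun := fun ψ => MemLp.toLp (fun x => g x * (ψ : Hilb N) x) ψ.2
      map_add' := fun a b => toLp_mul_add g a b a.2 b.2 (Submodule.add_mem _ a.2 b.2)
      map_smul' := by
        intro c a
        rw [RingHom.id_apply]
        exact toLp_mul_smul g c a a.2 (Submodule.smul_mem _ c a.2) }

/-- The function `f(p̂)` of the momentum operator: in the Fourier variable `ξ` (with
`(𝓕ψ)(ξ) = ∫ e^{-2πi⟨x,ξ⟩} ψ(x) dx`) the momentum is `p = 2πħ ξ`, so that `f(p̂)` is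
multiplication by `f (2πħ ξ)` on its maximal domain. -/
def momOp (ħ : ℝ) (f : Config N → ℂ) : Hilb N →ₗ.[ℂ] Hilb N where
  domain := (mulDomain fun ξ => f ((2 * Real.pi * ħ) • ξ)).comap
    (Lp.fourierTransformₗᵢ (Config N) ℂ).toLinearEquiv.toLinearMap
  toFun := (Lp.fourierTransformₗᵢ (Config N) ℂ).symm.toLinearEquiv.toLinearMap ∘ₗ
    (mulOp fun ξ => f ((2 * Real.pi * ħ) • ξ)).toFun ∘ₗ
      ((Lp.fourierTransformₗᵢ (Config N) ℂ).toLinearEquiv.toLinearMap.restrict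
        (p := (mulDomain fun ξ => f ((2 * Real.pi * ħ) • ξ)).comap
          (Lp.fourierTransformₗᵢ (Config N) ℂ).toLinearEquiv.toLinearMap)
        (q := mulDomain fun ξ => f ((2 * Real.pi * ħ) • ξ)) fun _ h => h)

theorem memLp_phase (κ : Config N) (ψ : Hilb N) :
    MemLp (fun x => Complex.exp (-Complex.I * (inner ℝ κ x : ℝ)) * ψ x) 2 volume := by
  refine (Lp.memLp ψ).of_le (AEStronglyMeasurable.mul ?_ (Lp.aestronglyMeasurable ψ)) ?_
  · exact Continuous.aestronglyMeasurable (by fun_prop)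
  · refine Eventually.of_forall fun x => ?_
    rw [norm_mul, Complex.norm_exp]
    simp

/-- The unitary operator `e^{-i κ·x̂}`. -/
def phase (κ : Config N) : Hilb N →ₗ[ℂ] Hilb N where
  toFun ψ := (memLp_phase κ ψ).toLp _
  map_add' a b := toLp_mul_add _ a b (memLp_phase κ a) (memLp_phase κ b) (memLp_phase κ (a + b))
  map_smul' c a := by
    rw [RingHom.id_apply]
    exact toLp_mul_smul _ c a (memLp_phase κ a) (memLp_phase κ (c • a))

/-- The operator `A = e^{-i κ·x̂} f(p̂)`. -/
def jumpOp (ħ : ℝ) (κ : Config N) (f : Config N → ℂ) : Hilb N →ₗ.[ℂ] Hilb N :=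
  (phase κ).compPMap (momOp ħ f)

/-- The operator `κ·x̂ + g(p̂)`, with `κ` and `g` real. -/
def driftOp (ħ : ℝ) (κ : Config N) (g : Config N → ℝ) : Hilb N →ₗ.[ℂ] Hilb N :=
  mulOp (fun x => ((inner ℝ κ x : ℝ) : ℂ)) + momOp ħ (fun p => (g p : ℂ))

/-! ## Hamiltonian, thermal state, Wigner and Blokhintsev functions -/

/-- `H` is a self-adjoint realization of `∑ₙ p̂ₙ² / (2 mₙ) + U(x̂)`: it is self-adjoint, and
`H ψ = -∑ₙ ħ²/(2 mₙ) ∂ₙ²ψ + U ψ` in the sense of distributions for every `ψ` in its domain. -/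
structure IsHamiltonian (ħ : ℝ) (m : Fin N → ℝ) (U : Config N → ℝ)
    (H : Hilb N →ₗ.[ℂ] Hilb N) : Prop where
  selfAdjoint : IsSelfAdjoint H
  locallyIntegrable : ∀ ψ ∈ H.domain, LocallyIntegrable (fun x => (U x : ℂ) * ψ x) volume
  acts : ∀ ψ ∈ H.domain, ∀ φ : Config N → ℂ, ContDiff ℝ ∞ φ → HasCompactSupport φ →
    ∫ x, φ x * app H ψ x =
      (∫ x, (∑ n, (-(ħ ^ 2 / (2 * m n)) : ℝ) *
        iteratedDeriv 2 (fun s : ℝ => φ (x + s • EuclideanSpace.single n (1 : ℝ))) 0) * ψ x)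
      + ∫ x, φ x * ((U x : ℂ) * ψ x)

/-- The spectral data of the thermal state `e^{-H/θ} / Tr e^{-H/θ}`: since `e^{-H/θ}` has finite
trace, `H` has an orthonormal basis of eigenvectors `ψ₀, ψ₁, …`, with energies `E₀, E₁, …` such
that `∑ₙ e^{-Eₙ/θ} < ∞`. -/
structure ThermalData (H : Hilb N →ₗ.[ℂ] Hilb N) (θ : ℝ) where
  basis : HilbertBasis ℕ ℂ (Hilb N)
  energy : ℕ → ℝ
  mem_domain : ∀ n, basis n ∈ H.domain
  eigen : ∀ n, app H (basis n) = (energy n : ℂ) • basis n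
  summable : Summable fun n => Real.exp (-(energy n) / θ)

namespace ThermalData

variable {H : Hilb N →ₗ.[ℂ] Hilb N} {θ : ℝ}

/-- The Boltzmann weight `e^{-Eₙ/θ} / ∑ⱼ e^{-Eⱼ/θ}`. -/
def weight (G : ThermalData H θ) (n : ℕ) : ℝ :=
  Real.exp (-(G.energy n) / θ) / ∑' j, Real.exp (-(G.energy j) / θ)

/-- The thermal state `ρ_θ = ∑ₙ wₙ |ψₙ⟩⟨ψₙ|` (the series converges in norm). -/
def state (G : ThermalData H θ) : Hilb N →L[ℂ] Hilb N :=
  ∑' n, (G.weight n : ℂ) • InnerProductSpace.rankOne ℂ (G.basis n) (G.basis n)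

end ThermalData

/-- The Wigner function of the pure state `|ψ⟩⟨ψ|`,
`W(p, x) = (2πħ)^{-N} ∫ e^{-i p·y/ħ} ψ(x + y/2) ψ*(x - y/2) dy`. -/
def wignerPure (ħ : ℝ) (ψ : Hilb N) (p x : Config N) : ℂ :=
  (((2 * Real.pi * ħ) ^ N)⁻¹ : ℝ) *
    ∫ y : Config N, Complex.exp (-Complex.I * ((inner ℝ p y / ħ : ℝ) : ℂ)) *
      (ψ (x + (1 / 2 : ℝ) • y) * star (ψ (x - (1 / 2 : ℝ) • y)))

/-- The Wigner function of the thermal state. -/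
def wigner (ħ : ℝ) {H : Hilb N →ₗ.[ℂ] Hilb N} {θ : ℝ} (G : ThermalData H θ)
    (p x : Config N) : ℂ :=
  ∑' n, (G.weight n : ℂ) * wignerPure ħ (G.basis n) p x

/-- The Blokhintsev function `B_θ(p, λ) = ∫ e^{i λ·x} W(p, x) dx` of the thermal state. -/
def blokhintsev (ħ : ℝ) {H : Hilb N →ₗ.[ℂ] Hilb N} {θ : ℝ} (G : ThermalData H θ)
    (p l : Config N) : ℂ :=
  ∫ x : Config N, Complex.exp (Complex.I * ((inner ℝ l x : ℝ) : ℂ)) * wigner ħ G p x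

/-! ## The master equation -/

/-- Density operators: positive operators of trace one. -/
structure IsDensityOp (ρ : Hilb N →L[ℂ] Hilb N) : Prop where
  pos : ρ.IsPositive
  trace : ∀ b : HilbertBasis ℕ ℂ (Hilb N), HasSum (fun n => inner ℂ (b n) (ρ (b n))) 1

/-- The vectors `φ` on which `L† φ` and `L† L φ` are defined. -/
def DissDomain (L : Hilb N →ₗ.[ℂ] Hilb N) : Set (Hilb N) :=
  {φ | φ ∈ L†.domain ∧ φ ∈ L.domain ∧ app L φ ∈ L†.domain}

/-- The matrix element `⟨φ| L ρ L† - ½ (L†L ρ + ρ L†L) |ψ⟩`. -/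
def dissForm (L : Hilb N →ₗ.[ℂ] Hilb N) (ρ : Hilb N →L[ℂ] Hilb N) (φ ψ : Hilb N) : ℂ :=
  inner ℂ (app L† φ) (ρ (app L† ψ)) -
    (1 / 2) * (inner ℂ (app L† (app L φ)) (ρ ψ) + inner ℂ φ (ρ (app L† (app L ψ))))

/-- The matrix element `⟨φ| [G, ρ] |ψ⟩` for a symmetric operator `G`. -/
def commForm (G : Hilb N →ₗ.[ℂ] Hilb N) (ρ : Hilb N →L[ℂ] Hilb N) (φ ψ : Hilb N) : ℂ :=
  inner ℂ (app G φ) (ρ ψ) - inner ℂ φ (ρ (app G ψ))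

/-- The parameters of a translation-invariant relaxation superoperator
`L_rel = ∑ₖ Lbd[e^{-i κₖ·x̂} fₖ(p̂)] - i [κ_aux·x̂ + f_aux(p̂), ⊙]`. -/
structure Relaxation (N K : ℕ) where
  κ : Fin K → Config N
  f : Fin K → Config N → ℂ
  κaux : Config N
  faux : Config N → ℝ

namespace Relaxation

variable {K : ℕ}

/-- The Lindblad operator `A_k = e^{-i κₖ·x̂} fₖ(p̂)`. -/
def A (R : Relaxation N K) (ħ : ℝ) (k : Fin K) : Hilb N →ₗ.[ℂ] Hilb N :=
  jumpOp ħ (R.κ k) (R.f k)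

/-- The generator `κ_aux·x̂ + f_aux(p̂)` of the drift. -/
def drift (R : Relaxation N K) (ħ : ℝ) : Hilb N →ₗ.[ℂ] Hilb N :=
  driftOp ħ R.κaux R.faux

/-- The vectors on which all operators that enter `L_rel` are defined. -/
def domain (R : Relaxation N K) (ħ : ℝ) : Set (Hilb N) :=
  {φ | φ ∈ (R.drift ħ).domain ∧ ∀ k, φ ∈ DissDomain (R.A ħ k)}

/-- The matrix element `⟨φ| L_rel[ρ] |ψ⟩`. -/
def form (R : Relaxation N K) (ħ : ℝ) (ρ : Hilb N →L[ℂ] Hilb N) (φ ψ : Hilb N) : ℂ :=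
  ∑ k, dissForm (R.A ħ k) ρ φ ψ - Complex.I * commForm (R.drift ħ) ρ φ ψ

/-- `L_rel = 0`. -/
def IsZero (R : Relaxation N K) (ħ : ℝ) : Prop :=
  ∀ ρ : Hilb N →L[ℂ] Hilb N, IsDensityOp ρ →
    ∀ φ ∈ R.domain ħ, ∀ ψ ∈ R.domain ħ, R.form ħ ρ φ ψ = 0

/-- The natural test vectors of the master equation: those on which `H` and all operators that
enter `L_rel` are defined. -/
def testVectors (R : Relaxation N K) (ħ : ℝ) (H : Hilb N →ₗ.[ℂ] Hilb N) : Set (Hilb N) :=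
  {φ | φ ∈ H.domain ∧ φ ∈ R.domain ħ}

/-- `fₖ ∈ L⁴_loc` and `f_aux ∈ L²_loc`: all operators that enter `L_rel` are defined on the
wave functions that are smooth and compactly supported in the momentum representation. -/
structure IsRegular (R : Relaxation N K) : Prop where
  f_mem : ∀ k, ∀ S : Set (Config N), IsCompact S → MemLp (R.f k) 4 (volume.restrict S)
  faux_mem : ∀ S : Set (Config N), IsCompact S → MemLp R.faux 2 (volume.restrict S)

/-- Compatibility of the domains of `H` and of `L_rel`: each wave function that is smooth and
compactly supported in the momentum representation is a limit of common test vectors, in the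
graph norm of the operators that enter `L_rel`. -/
def HasCommonCore (R : Relaxation N K) (ħ : ℝ) (H : Hilb N →ₗ.[ℂ] Hilb N) : Prop :=
  ∀ φ : Hilb N, (∃ g : Config N → ℂ, ContDiff ℝ ∞ g ∧ HasCompactSupport g ∧
      (𝓕 φ : Hilb N) =ᵐ[volume] g) →
    ∀ ε > 0, ∃ χ ∈ R.testVectors ħ H, ‖χ - φ‖ < ε ∧
      ‖app (R.drift ħ) χ - app (R.drift ħ) φ‖ < ε ∧
      ∀ k, ‖app (R.A ħ k)† χ - app (R.A ħ k)† φ‖ < ε ∧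
        ‖app (R.A ħ k)† (app (R.A ħ k) χ) - app (R.A ħ k)† (app (R.A ħ k) φ)‖ < ε

/-- `Tr (Aₖ ρ_θ Aₖ†) = ⟨|fₖ(p̂)|²⟩_θ < ∞` for all `k`. -/
def FiniteRates (R : Relaxation N K) (ħ : ℝ) {H : Hilb N →ₗ.[ℂ] Hilb N} {θ : ℝ}
    (G : ThermalData H θ) : Prop :=
  ∀ k, (∀ n, G.basis n ∈ (R.A ħ k).domain) ∧
    Summable fun n => G.weight n * ‖app (R.A ħ k) (G.basis n)‖ ^ 2

/-- `ρ(t)`, `t ≥ 0`, is a trajectory of the process: a family of density operators with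
`∂ρ/∂t = (i/ħ) [ρ, H] + L_rel[ρ]`, in the weak sense that this holds for the matrix elements
between all test vectors. -/
structure IsTrajectory (R : Relaxation N K) (ħ : ℝ) (H : Hilb N →ₗ.[ℂ] Hilb N)
    (ρ : ℝ → Hilb N →L[ℂ] Hilb N) : Prop where
  density : ∀ t, 0 ≤ t → IsDensityOp (ρ t)
  master : ∀ φ ∈ R.testVectors ħ H, ∀ ψ ∈ R.testVectors ħ H, ∀ t, 0 ≤ t →
    HasDerivWithinAt (fun s => inner ℂ φ (ρ s ψ))
      (-(Complex.I / (ħ : ℂ)) * commForm H (ρ t) φ ψ + R.form ħ (ρ t) φ ψ) (Ici 0) t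

end Relaxation

/-- `ρ(t) → σ` as `t → ∞`, for all matrix elements (implied by convergence in trace norm, and
equivalent to it when all `ρ(t)` and `σ` are density operators). -/
def ConvergesTo (ρ : ℝ → Hilb N →L[ℂ] Hilb N) (σ : Hilb N →L[ℂ] Hilb N) : Prop :=
  ∀ φ ψ : Hilb N, Tendsto (fun t => inner ℂ φ (ρ t ψ)) atTop (𝓝 (inner ℂ φ (σ ψ)))

end NoThermalization

end

/-! Up to a constant, `B_θ(p, λ)` is the momentum kernel `r` of `ρ_θ` at the pair of momenta `p ∓
ħλ/2`; positivity of `B_θ` therefore makes `r` real and strictly positive almost everywhere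
(`kernel_pos`). If a trajectory converges to `ρ_θ`, its matrix elements and their derivatives
converge, so `L_rel[ρ_θ] = 0`, first between test vectors and then, by the common core, between wave
functions whose Fourier transform is smooth with compact support.

Let `φ_c` be the momentum translates of a vector with a nonnegative bump as Fourier transform, and
consider the balance `⟨φ_c| L_rel[ρ_θ] |φ_c⟩ = 0` (`diag_balance`). Each jump operator contributes a
function of `c` at the kicked momentum, minus the same function at `c`, minus the dissipation `½ ∬
|f(ξ) - f(η)|² β(ξ) β(η) r(ξ, η)`, with `β` the translated bump. The force contributes a directional
derivative, and `f_aux` nothing. Integration over `c` removes the differences and the derivative;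
the dissipations, being nonnegative, vanish, and `r > 0` forces every `f_k` to be constant
(`ae_const_f`).

For constant amplitudes a maximum principle applies to `S(c) = ⟨φ_c| ρ_θ |φ_c⟩`, which is
continuous, positive at `0` and zero at infinity. A maximum propagates along every kick with nonzero
amplitude, contradicting the decay unless that kick is zero; the remaining force term then makes `S`
constant along `κ_aux`, so `κ_aux = 0` (`kicks_eq_zero`). What is left says that `f_aux(p̂)`
commutes with `ρ_θ`, and positivity of `r` makes `f_aux` constant (`ae_const_of_commute`).

Hence `L_rel = 0` and the evolution is unitary. Matrix elements between energy eigenvectors are pure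
oscillations, and these converge only if they are constant, so `ρ(0) = ρ_θ`
(`IsTrivial.initial_eq`). -/

noncomputable section

namespace NoThermalization

open SchwartzMap ComplexConjugate

variable {N K : ℕ}

/-! ### Fourier transform, modulations and the operators of the master equation on `L²`. -/

section

/-- The Fourier transform as a unitary operator on the state space. -/
abbrev FT : Hilb N ≃ₗᵢ[ℂ] Hilb N := Lp.fourierTransformₗᵢ (Config N) ℂ

theorem inner_FT (x y : Hilb N) : inner ℂ (FT x) (FT y) = inner ℂ x y :=
  FT.inner_map_map x y

theorem inner_hilb (x y : Hilb N) : inner ℂ x y = ∫ ξ, conj (x ξ) * y ξ := by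
  rw [L2.inner_def]
  simp only [RCLike.inner_apply, mul_comm]

/-! ### Phases -/

theorem phase_coe (κ : Config N) (ψ : Hilb N) :
    phase κ ψ =ᵐ[volume] fun x => Complex.exp (-Complex.I * (inner ℝ κ x : ℝ)) * ψ x :=
  MemLp.coeFn_toLp (memLp_phase κ ψ)

theorem phase_zero (ψ : Hilb N) : phase 0 ψ = ψ := by
  refine Lp.ext ?_
  filter_upwards [phase_coe 0 ψ] with x hx
  simp [hx]

theorem phase_phase (κ κ' : Config N) (ψ : Hilb N) :
    phase κ (phase κ' ψ) = phase (κ + κ') ψ := by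
  refine Lp.ext ?_
  filter_upwards [phase_coe κ (phase κ' ψ), phase_coe κ' ψ, phase_coe (κ + κ') ψ] with x h1 h2 h3
  rw [h1, h2, h3, ← mul_assoc, ← Complex.exp_add]
  congr 2
  rw [inner_add_left]
  push_cast
  ring

theorem inner_phase_phase (κ : Config N) (x y : Hilb N) :
    inner ℂ (phase κ x) (phase κ y) = inner ℂ x y := by
  rw [inner_hilb, inner_hilb]
  refine integral_congr_ae ?_
  filter_upwards [phase_coe κ x, phase_coe κ y] with ξ h1 h2
  rw [h1, h2, map_mul, ← Complex.exp_conj]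
  have : conj (-Complex.I * ((inner ℝ κ ξ : ℝ) : ℂ)) = -(-Complex.I * (inner ℝ κ ξ : ℝ)) := by
    simp
  rw [this, mul_mul_mul_comm, ← Complex.exp_add]
  simp

theorem inner_phase_left (κ : Config N) (x y : Hilb N) :
    inner ℂ (phase κ x) y = inner ℂ x (phase (-κ) y) := by
  rw [← inner_phase_phase (-κ), phase_phase, neg_add_cancel, phase_zero]

theorem inner_phase_right (κ : Config N) (x y : Hilb N) :
    inner ℂ x (phase κ y) = inner ℂ (phase (-κ) x) y := by
  rw [inner_phase_left, neg_neg]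

theorem norm_phase (κ : Config N) (x : Hilb N) : ‖phase κ x‖ = ‖x‖ := by
  rw [norm_eq_sqrt_re_inner (𝕜 := ℂ), norm_eq_sqrt_re_inner (𝕜 := ℂ), inner_phase_phase]

/-! ### Wave functions that are Schwartz in the momentum representation -/

/-- The translate `ξ ↦ β (ξ - c)`. -/
abbrev shift (c : Config N) (β : 𝓢(Config N, ℂ)) : 𝓢(Config N, ℂ) := compSubConstCLM ℂ c β

/-- The wave function whose Fourier transform is `β`. -/
def vec (β : 𝓢(Config N, ℂ)) : Hilb N := FT.symm (β.toLp 2)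

theorem FT_vec (β : 𝓢(Config N, ℂ)) : FT (vec β) = β.toLp 2 := FT.apply_symm_apply _

theorem FT_vec_ae (β : 𝓢(Config N, ℂ)) : FT (vec β) =ᵐ[volume] β := by
  rw [FT_vec]; exact β.coeFn_toLp 2

theorem vec_eq (β : 𝓢(Config N, ℂ)) : vec β = (𝓕⁻ β).toLp 2 :=
  SchwartzMap.toLp_fourierInv_eq β

theorem vec_fourier (β : 𝓢(Config N, ℂ)) : vec (𝓕 β) = β.toLp 2 := by
  rw [vec_eq, FourierTransform.fourierInv_fourier_eq]

/-- A modulation in position is a translation of the Fourier variable; the factor `(2π)⁻¹` comes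
from the characters `e^{2πi⟨x,ξ⟩}`. -/
theorem phase_vec (κ : Config N) (β : 𝓢(Config N, ℂ)) :
    phase κ (vec β) = vec (shift (-(2 * Real.pi)⁻¹ • κ) β) := by
  rw [vec_eq, vec_eq]
  refine Lp.ext ?_
  filter_upwards [phase_coe κ ((𝓕⁻ β).toLp 2), (𝓕⁻ β).coeFn_toLp 2,
    (𝓕⁻ (shift (-(2 * Real.pi)⁻¹ • κ) β)).coeFn_toLp 2] with x h1 h2 h3
  rw [h1, h2, h3, SchwartzMap.fourierInv_coe, SchwartzMap.fourierInv_coe, Real.fourierInv_eq',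
    Real.fourierInv_eq', ← integral_const_mul]
  rw [← integral_add_right_eq_self _ ((2 * Real.pi)⁻¹ • κ)]
  refine integral_congr_ae (Eventually.of_forall fun ξ => ?_)
  simp only [compSubConstCLM_apply, smul_eq_mul, ← mul_assoc, ← Complex.exp_add, neg_smul,
    sub_neg_eq_add]
  congr 2
  rw [inner_add_left, inner_smul_left]
  simp only [conj_trivial]
  push_cast
  field_simp
  ring

theorem phase_two_pi_vec (c : Config N) (β : 𝓢(Config N, ℂ)) :
    phase (-(2 * Real.pi) • c) (vec β) = vec (shift c β) := by
  rw [phase_vec, smul_smul]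
  congr 2
  have : -(2 * Real.pi)⁻¹ * -(2 * Real.pi) = 1 := by
    field_simp
  rw [this, one_smul]

theorem shift_shift (c d : Config N) (β : 𝓢(Config N, ℂ)) :
    shift c (shift d β) = shift (c + d) β := by
  ext x
  simp only [compSubConstCLM_apply]
  congr 1
  abel

/-! ### The operators of the master equation -/

theorem app_of_mem {T : Hilb N →ₗ.[ℂ] Hilb N} {x : Hilb N} (h : x ∈ T.domain) :
    app T x = T ⟨x, h⟩ := dif_pos h

theorem mem_mulOp {g : Config N → ℂ} {ψ : Hilb N} :
    ψ ∈ (mulOp g).domain ↔ MemLp (fun x => g x * ψ x) 2 volume := Iff.rfl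

theorem app_mulOp {g : Config N → ℂ} {ψ : Hilb N} (h : MemLp (fun x => g x * ψ x) 2 volume) :
    app (mulOp g) ψ = h.toLp _ := by
  rw [app_of_mem (mem_mulOp.2 h)]
  rfl

variable {ħ : ℝ} {f : Config N → ℂ} {κ : Config N}

theorem mem_momOp {ψ : Hilb N} : ψ ∈ (momOp ħ f).domain ↔
    MemLp (fun ξ => f ((2 * Real.pi * ħ) • ξ) * FT ψ ξ) 2 volume := Iff.rfl

theorem app_momOp {ψ : Hilb N}
    (h : MemLp (fun ξ => f ((2 * Real.pi * ħ) • ξ) * FT ψ ξ) 2 volume) :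
    app (momOp ħ f) ψ = FT.symm (h.toLp _) := by
  rw [app_of_mem (mem_momOp.2 h)]
  rfl

theorem mem_jumpOp {ψ : Hilb N} : ψ ∈ (jumpOp ħ κ f).domain ↔
    MemLp (fun ξ => f ((2 * Real.pi * ħ) • ξ) * FT ψ ξ) 2 volume := Iff.rfl

theorem app_jumpOp {ψ : Hilb N}
    (h : MemLp (fun ξ => f ((2 * Real.pi * ħ) • ξ) * FT ψ ξ) 2 volume) :
    app (jumpOp ħ κ f) ψ = phase κ (FT.symm (h.toLp _)) := by
  rw [app_of_mem (mem_jumpOp.2 h)]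
  rfl

/-- Multiplication by `a` maps compactly supported continuous functions to `L²`. -/
def MulCompact (a : Config N → ℂ) : Prop :=
  ∀ u : Config N → ℂ, Continuous u → HasCompactSupport u → MemLp (fun ξ => a ξ * u ξ) 2 volume

theorem memLp_mul_of_loc {a : Config N → ℂ} {p : ENNReal}
    (ha : ∀ S : Set (Config N), IsCompact S → MemLp a p (volume.restrict S))
    {u : Config N → ℂ} (hu : Continuous u) (hc : HasCompactSupport u) :
    MemLp (fun ξ => a ξ * u ξ) p volume := by
  obtain ⟨C, hC⟩ := hu.bounded_above_of_compact_support hc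
  have h1 : MemLp (fun ξ => a ξ * u ξ) p (volume.restrict (tsupport u)) :=
    MemLp.of_le_mul (c := C) (ha _ hc)
      ((ha _ hc).aestronglyMeasurable.mul hu.aestronglyMeasurable) <|
      Eventually.of_forall fun ξ => by
        rw [norm_mul, mul_comm]
        exact mul_le_mul_of_nonneg_right (hC ξ) (norm_nonneg _)
  rw [← memLp_indicator_iff_restrict (isClosed_tsupport u).measurableSet] at h1
  refine h1.ae_eq (Eventually.of_forall fun ξ => ?_)
  by_cases hξ : ξ ∈ tsupport u
  · rw [indicator_of_mem hξ]
  · simp only [indicator_of_notMem hξ, image_eq_zero_of_notMem_tsupport hξ, mul_zero]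

/-- Passes from the momentum `p` to the Fourier variable `ξ = p/(2πħ)`: a dilation maps the
restricted Lebesgue measure to a finite multiple of a restricted one. -/
theorem loc_comp_smul {a : Config N → ℂ} {p : ENNReal}
    (ha : ∀ S : Set (Config N), IsCompact S → MemLp a p (volume.restrict S)) {c : ℝ} (hc : 0 < c)
    (S : Set (Config N)) (hS : IsCompact S) :
    MemLp (fun ξ => a (c • ξ)) p (volume.restrict S) := by
  have hemb : MeasurableEmbedding (fun ξ : Config N => c • ξ) :=
    (Homeomorph.smulOfNeZero c hc.ne').measurableEmbedding
  have himg : IsCompact ((fun ξ : Config N => c • ξ) '' S) := hS.image (by fun_prop)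
  have h := ha _ himg
  have hmap : Measure.map (fun ξ : Config N => c • ξ) (volume.restrict S)
      = ENNReal.ofReal |(c ^ Module.finrank ℝ (Config N))⁻¹| •
        (volume.restrict ((fun ξ : Config N => c • ξ) '' S)) := by
    have hpre : (fun ξ : Config N => c • ξ) ⁻¹' ((fun ξ : Config N => c • ξ) '' S) = S :=
      hemb.injective.preimage_image S
    conv_lhs => rw [← hpre]
    rw [← hemb.restrict_map]
    have := Measure.map_addHaar_smul (volume : Measure (Config N)) hc.ne'
    rw [this, Measure.restrict_smul]
  have h2 : MemLp a p (Measure.map (fun ξ : Config N => c • ξ) (volume.restrict S)) := by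
    rw [hmap]
    exact h.smul_measure ENNReal.ofReal_ne_top
  exact (hemb.memLp_map_measure_iff).1 h2

theorem MulCompact.vec_mem {f : Config N → ℂ} (hf : MulCompact fun ξ => f ((2 * Real.pi * ħ) • ξ))
    (β : 𝓢(Config N, ℂ)) (hβ : HasCompactSupport β) :
    MemLp (fun ξ => f ((2 * Real.pi * ħ) • ξ) * FT (vec β) ξ) 2 volume := by
  refine (hf β β.continuous hβ).ae_eq ?_
  filter_upwards [FT_vec_ae β] with ξ h
  rw [h]

theorem dense_vec : Dense {x : Hilb N | ∃ β : 𝓢(Config N, ℂ), HasCompactSupport β ∧ x = vec β} := by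
  have h : Dense {x : Hilb N | ∃ β : 𝓢(Config N, ℂ), HasCompactSupport β ∧ x = β.toLp 2} := by
    intro g
    refine (mem_closure_iff_nhds_basis Metric.nhds_basis_closedBall).2 fun ε hε ↦ ?_
    obtain ⟨g', hg₁, hg₂, hg₃⟩ := MemLp.exist_eLpNorm_sub_le (by simp) (by simp) (Lp.memLp g) hε
    refine ⟨(hg₁.toSchwartzMap hg₂).toLp 2, ⟨hg₁.toSchwartzMap hg₂, hg₁, rfl⟩, ?_⟩
    have : (g : Config N → ℂ) - ((hg₁.toSchwartzMap hg₂).toLp 2 : Config N → ℂ)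
        =ᵐ[volume] (g : Config N → ℂ) - g' := by
      filter_upwards [(hg₁.toSchwartzMap hg₂).coeFn_toLp 2]
      simp
    simp only [Metric.mem_closedBall', Lp.dist_def, eLpNorm_congr_ae this]
    grw [hg₃, ENNReal.toReal_ofReal hε.le]
    simp
  have h2 := (FT (N := N)).symm.toHomeomorph.surjective.denseRange.dense_image
    (FT (N := N)).symm.continuous h
  refine h2.mono ?_
  rintro _ ⟨_, ⟨β, hβ, rfl⟩, rfl⟩
  exact ⟨β, hβ, rfl⟩

theorem dense_jumpOp (hf : MulCompact fun ξ => f ((2 * Real.pi * ħ) • ξ)) :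
    Dense ((jumpOp ħ κ f).domain : Set (Hilb N)) := by
  refine dense_vec.mono ?_
  rintro _ ⟨β, hβ, rfl⟩
  exact mem_jumpOp.2 (hf.vec_mem β hβ)

theorem inner_FT_symm_toLp {u : Config N → ℂ} (hu : MemLp u 2 volume) (x : Hilb N) :
    inner ℂ (FT.symm (hu.toLp u)) x = ∫ ξ, conj (u ξ) * FT x ξ := by
  rw [← inner_FT, LinearIsometryEquiv.apply_symm_apply, inner_hilb]
  refine integral_congr_ae ?_
  filter_upwards [hu.coeFn_toLp] with ξ h
  rw [h]

/-- Only the inclusion of `conj f (p̂) e^{iκ·x̂}` in the adjoint is needed, since all vectors used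
below lie in this explicit domain. Density of the domain of `jumpOp` makes the adjoint unique. -/
theorem adjoint_jumpOp (hf : MulCompact fun ξ => f ((2 * Real.pi * ħ) • ξ)) (y : Hilb N)
    (h : MemLp (fun ξ => conj (f ((2 * Real.pi * ħ) • ξ)) * FT (phase (-κ) y) ξ) 2 volume) :
    y ∈ (jumpOp ħ κ f)†.domain ∧ app (jumpOp ħ κ f)† y = FT.symm (h.toLp _) := by
  have key : ∀ x : (jumpOp ħ κ f).domain,
      inner ℂ (FT.symm (h.toLp _)) (x : Hilb N) = inner ℂ y (jumpOp ħ κ f x) := by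
    rintro ⟨x, hx⟩
    rw [← app_of_mem hx, app_jumpOp (mem_jumpOp.1 hx), inner_phase_right, inner_FT_symm_toLp,
      ← inner_FT, LinearIsometryEquiv.apply_symm_apply, inner_hilb]
    refine integral_congr_ae ?_
    filter_upwards [(mem_jumpOp.1 hx).coeFn_toLp] with ξ h1
    rw [h1, map_mul, Complex.conj_conj]
    ring
  have hm := LinearPMap.mem_adjoint_domain_of_exists y ⟨_, key⟩
  exact ⟨hm, by rw [app_of_mem hm, LinearPMap.adjoint_apply_eq (dense_jumpOp hf) _ key]⟩

end

/-! ### The thermal state -/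

namespace ThermalData

variable {H : Hilb N →ₗ.[ℂ] Hilb N} {θ : ℝ} (G : ThermalData H θ)

theorem weight_pos (n : ℕ) : 0 < G.weight n :=
  div_pos (Real.exp_pos _) (G.summable.tsum_pos (fun _ => (Real.exp_pos _).le) 0 (Real.exp_pos _))

theorem summable_weight : Summable G.weight := G.summable.div_const _

theorem norm_basis (n : ℕ) : ‖G.basis n‖ = 1 := G.basis.orthonormal.1 n

theorem hasSum_inner_state (φ ψ : Hilb N) :
    HasSum (fun n => (G.weight n : ℂ) * (inner ℂ φ (G.basis n) * inner ℂ (G.basis n) ψ))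
      (inner ℂ φ (G.state ψ)) := by
  have hs : Summable fun n =>
      (G.weight n : ℂ) • InnerProductSpace.rankOne ℂ (G.basis n) (G.basis n) := by
    refine Summable.of_norm_bounded G.summable_weight fun n => ?_
    rw [norm_smul, InnerProductSpace.norm_rankOne, G.norm_basis, mul_one, mul_one,
      Complex.norm_real, Real.norm_of_nonneg (G.weight_pos n).le]
  have h := (hs.hasSum.mapL ((innerSL ℂ φ).comp (ContinuousLinearMap.apply ℂ (Hilb N) ψ)))
  refine (h.congr_fun fun n => ?_)
  simp [mul_comm]

theorem inner_state_comm (φ ψ : Hilb N) :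
    inner ℂ φ (G.state ψ) = conj (inner ℂ ψ (G.state φ)) := by
  refine (G.hasSum_inner_state φ ψ).unique ?_
  refine ((G.hasSum_inner_state ψ φ).mapL (Complex.conjCLE : ℂ →L[ℝ] ℂ)).congr_fun fun n => ?_
  simp [mul_comm]

theorem hasSum_re_inner_state (φ : Hilb N) :
    HasSum (fun n => G.weight n * ‖inner ℂ (G.basis n) φ‖ ^ 2) (inner ℂ φ (G.state φ)).re := by
  refine ((Complex.hasSum_re (G.hasSum_inner_state φ φ)).congr_fun fun n => ?_)
  rw [← inner_conj_symm φ, Complex.conj_mul']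
  norm_cast

/-- By symmetry of `H`, both halves are the sum of the same series `∑ wₙ Eₙ ⟨φ, ψₙ⟩⟨ψₙ, ψ⟩`; it
converges because each half is a matrix element of the bounded state. -/
theorem commForm_state (hH : IsSelfAdjoint H) {φ ψ : Hilb N} (hφ : φ ∈ H.domain)
    (hψ : ψ ∈ H.domain) : commForm H G.state φ ψ = 0 := by
  have hsym : ∀ x ∈ H.domain, ∀ y ∈ H.domain, inner ℂ (app H x) y = inner ℂ x (app H y) := by
    intro x hx y hy
    have h := LinearPMap.adjoint_isFormalAdjoint hH.dense_domain
    rw [LinearPMap.isSelfAdjoint_def.1 hH] at h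
    rw [app_of_mem hx, app_of_mem hy]
    exact h ⟨x, hx⟩ ⟨y, hy⟩
  refine sub_eq_zero.2 ((G.hasSum_inner_state _ _).unique
    ((G.hasSum_inner_state _ _).congr_fun fun n => ?_))
  rw [hsym _ hφ _ (G.mem_domain n), ← hsym _ (G.mem_domain n) _ hψ, G.eigen, inner_smul_left,
    inner_smul_right, Complex.conj_ofReal]
  ring

end ThermalData

/-! ### Stationarity of limits of trajectories -/

/-- If a function and its derivative converge at infinity, the derivative tends to zero. -/
theorem eq_zero_of_tendsto_deriv {y d : ℝ → ℂ} {L D : ℂ}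
    (hy : ∀ t, 0 ≤ t → HasDerivWithinAt y (d t) (Ici 0) t)
    (hL : Tendsto y atTop (𝓝 L)) (hD : Tendsto d atTop (𝓝 D)) : D = 0 := by
  have h1 : Tendsto (fun t : ℝ => y (t + 1) - y t - D) atTop (𝓝 (L - L - D)) :=
    ((hL.comp (tendsto_atTop_add_const_right _ 1 tendsto_id)).sub hL).sub_const D
  rw [sub_self, zero_sub] at h1
  refine norm_le_zero_iff.1 (le_of_forall_pos_le_add fun ε hε => ?_)
  rw [zero_add, ← norm_neg]
  refine le_of_tendsto h1.norm ?_
  have h2 : ∀ᶠ t in atTop, ‖d t - D‖ < ε := by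
    simpa [dist_eq_norm] using (Metric.tendsto_nhds.1 hD) ε hε
  obtain ⟨T, hT⟩ := eventually_atTop.1 h2
  filter_upwards [eventually_ge_atTop (max T 0)] with t ht
  have hT' : T ≤ t := (le_max_left _ _).trans ht
  have h0 : 0 ≤ t := (le_max_right _ _).trans ht
  -- Mean value inequality for `y(s) - sD` on `[t, t + 1]`: the increment of `y` over a unit
  -- interval is within `ε` of `D`, and it tends to zero.
  have h3 := (convex_Icc t (t + 1)).norm_image_sub_le_of_norm_hasDerivWithin_le
    (f := fun s => y s - s * D) (f' := fun s => d s - D) (C := ε) (x := t) (y := t + 1) ?_ ?_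
    ⟨le_rfl, by linarith⟩ ⟨by linarith, le_rfl⟩
  · have h4 : y (t + 1) - ((t + 1 : ℝ) : ℂ) * D - (y t - (t : ℂ) * D) = y (t + 1) - y t - D := by
      push_cast; ring
    rw [h4] at h3
    simpa using h3
  · intro s hs
    have := (hy s (h0.trans hs.1)).mono (t := Ici 0) (s := Icc t (t + 1))
      fun z hz => h0.trans hz.1
    refine (this.sub ((Complex.ofRealCLM.hasDerivAt
      (x := s)).hasDerivWithinAt.mul_const D)).congr_deriv ?_
    simp
  · exact fun s hs => (hT s (hT'.trans hs.1)).le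

namespace Relaxation

variable {H : Hilb N →ₗ.[ℂ] Hilb N} {θ ħ : ℝ} {R : Relaxation N K}

theorem tendsto_form {ρ : ℝ → Hilb N →L[ℂ] Hilb N} {σ : Hilb N →L[ℂ] Hilb N}
    (hρ : ConvergesTo ρ σ) (φ ψ : Hilb N) :
    Tendsto (fun t => R.form ħ (ρ t) φ ψ) atTop (𝓝 (R.form ħ σ φ ψ)) :=
  (tendsto_finsetSum _ fun _ _ => (hρ _ _).sub (((hρ _ _).add (hρ _ _)).const_mul _)).sub
    (((hρ _ _).sub (hρ _ _)).const_mul _)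

/-- The right-hand side of the master equation is a finite combination of matrix elements of `ρ(t)`
between fixed vectors, so it converges too. Its limit is zero, and the Hamiltonian part of the limit
vanishes by itself. -/
theorem form_state_of_tendsto (G : ThermalData H θ) (hH : IsSelfAdjoint H)
    {ρ : ℝ → Hilb N →L[ℂ] Hilb N} (hρ : R.IsTrajectory ħ H ρ) (hc : ConvergesTo ρ G.state)
    {φ ψ : Hilb N} (hφ : φ ∈ R.testVectors ħ H) (hψ : ψ ∈ R.testVectors ħ H) :
    R.form ħ G.state φ ψ = 0 := by
  have h := eq_zero_of_tendsto_deriv (hρ.master φ hφ ψ hψ) (hc φ ψ)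
    ((((hc _ _).sub (hc _ _)).const_mul _).add (tendsto_form hc φ ψ))
  have h0 := G.commForm_state hH hφ.1 hψ.1
  rw [commForm] at h0
  rwa [h0, mul_zero, zero_add] at h

theorem HasCommonCore.exists_seq (hcore : R.HasCommonCore ħ H) (β : 𝓢(Config N, ℂ))
    (hβ : HasCompactSupport β) :
    ∃ χ : ℕ → Hilb N, (∀ j, χ j ∈ R.testVectors ħ H) ∧ Tendsto χ atTop (𝓝 (vec β)) ∧
      Tendsto (fun j => app (R.drift ħ) (χ j)) atTop (𝓝 (app (R.drift ħ) (vec β))) ∧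
      ∀ k, Tendsto (fun j => app (R.A ħ k)† (χ j)) atTop (𝓝 (app (R.A ħ k)† (vec β))) ∧
        Tendsto (fun j => app (R.A ħ k)† (app (R.A ħ k) (χ j))) atTop
          (𝓝 (app (R.A ħ k)† (app (R.A ħ k) (vec β)))) := by
  have h := hcore (vec β) ⟨β, β.smooth ⊤, hβ, FT_vec_ae β⟩
  choose χ hχ h1 h2 h3 using fun j : ℕ => h (1 / ((j : ℝ) + 1)) Nat.one_div_pos_of_nat
  have key : ∀ (x : ℕ → Hilb N) (y : Hilb N), (∀ j, ‖x j - y‖ < 1 / ((j : ℝ) + 1)) →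
      Tendsto x atTop (𝓝 y) := fun x y hxy =>
    tendsto_iff_norm_sub_tendsto_zero.2 (squeeze_zero (fun _ => norm_nonneg _)
      (fun j => (hxy j).le) tendsto_one_div_add_atTop_nhds_zero_nat)
  exact ⟨χ, hχ, key _ _ h1, key _ _ h2,
    fun k => ⟨key _ _ fun j => (h3 j k).1, key _ _ fun j => (h3 j k).2⟩⟩

/-- `H` does not enter `form`, so approximation in the graph norms of the relaxation operators alone
suffices. -/
theorem form_vec_of_testVectors (hcore : R.HasCommonCore ħ H) {ρ : Hilb N →L[ℂ] Hilb N}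
    (h : ∀ φ ∈ R.testVectors ħ H, ∀ ψ ∈ R.testVectors ħ H, R.form ħ ρ φ ψ = 0)
    (α β : 𝓢(Config N, ℂ)) (hα : HasCompactSupport α) (hβ : HasCompactSupport β) :
    R.form ħ ρ (vec α) (vec β) = 0 := by
  obtain ⟨x, hx, x1, x2, x3⟩ := hcore.exists_seq α hα
  obtain ⟨y, hy, y1, y2, y3⟩ := hcore.exists_seq β hβ
  have hρ : ∀ {z : ℕ → Hilb N} {z' : Hilb N}, Tendsto z atTop (𝓝 z') →
      Tendsto (fun j => ρ (z j)) atTop (𝓝 (ρ z')) := fun hz => (ρ.continuous.tendsto _).comp hz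
  have hlim : Tendsto (fun j => R.form ħ ρ (x j) (y j)) atTop
      (𝓝 (R.form ħ ρ (vec α) (vec β))) := by
    refine (tendsto_finsetSum _ fun k _ => ?_).sub (Tendsto.const_mul _ ?_)
    · exact ((x3 k).1.inner (hρ (y3 k).1)).sub
        ((((x3 k).2.inner (hρ y1)).add (x1.inner (hρ (y3 k).2))).const_mul _)
    · exact (x2.inner (hρ y1)).sub (x1.inner (hρ y2))
  refine tendsto_nhds_unique hlim (tendsto_const_nhds.congr fun j => ?_)
  exact (h _ (hx j) _ (hy j)).symm

end Relaxation

/-! ### The thermal state in the momentum representation -/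

theorem integrable_tsum_of_summable {α 𝕜 : Type*} [RCLike 𝕜] [MeasurableSpace α] {μ : Measure α}
    {F : ℕ → α → 𝕜} (hF : ∀ n, Integrable (F n) μ) (hs : Summable fun n => ∫ a, ‖F n a‖ ∂μ) :
    Integrable (fun a => ∑' n, F n a) μ := by
  refine ⟨(AEMeasurable.tsum fun n => (hF n).aemeasurable).aestronglyMeasurable, ?_⟩
  refine (lintegral_mono fun a => enorm_tsum_le_tsum_enorm).trans_lt ?_
  rw [lintegral_tsum fun n => (hF n).aestronglyMeasurable.enorm]
  have h : ∀ n, ∫⁻ a, ‖F n a‖ₑ ∂μ = ENNReal.ofReal (∫ a, ‖F n a‖ ∂μ) := fun n =>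
    (ofReal_integral_norm_eq_lintegral_enorm (hF n)).symm
  simp_rw [h]
  exact hs.tsum_ofReal_lt_top

theorem integral_norm_sq (x : Hilb N) : ∫ ξ, ‖x ξ‖ ^ 2 = ‖x‖ ^ 2 := by
  rw [norm_sq_eq_re_inner (𝕜 := ℂ), inner_hilb]
  simp_rw [Complex.conj_mul']
  have h2 : ∫ ξ, ((‖x ξ‖ : ℂ)) ^ 2 = ((∫ ξ, ‖x ξ‖ ^ 2 : ℝ) : ℂ) := by
    rw [← integral_complex_ofReal]; simp
  rw [h2]
  rfl

theorem integrable_norm_sq (x : Hilb N) : Integrable (fun ξ => ‖x ξ‖ ^ 2) volume :=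
  (Lp.memLp x).integrable_norm_pow (by norm_num)

theorem integrable_conj_mul (x y : Hilb N) : Integrable (fun ξ => conj (x ξ) * y ξ) volume :=
  MemLp.integrable_mul (p := 2) (q := 2) ((Lp.memLp x).star) (Lp.memLp y)

theorem integral_norm_conj_mul_le (x y : Hilb N) :
    ∫ ξ, ‖conj (x ξ) * y ξ‖ ≤ (‖x‖ ^ 2 + ‖y‖ ^ 2) / 2 := by
  rw [← integral_norm_sq, ← integral_norm_sq, ← integral_add (integrable_norm_sq x)
    (integrable_norm_sq y), ← integral_div]
  refine integral_mono (integrable_conj_mul x y).norm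
    (((integrable_norm_sq x).add (integrable_norm_sq y)).div_const 2) fun ξ => ?_
  simp only [norm_mul, RCLike.norm_conj]
  nlinarith [sq_nonneg (‖x ξ‖ - ‖y ξ‖)]

namespace ThermalData

variable {H : Hilb N →ₗ.[ℂ] Hilb N} {θ : ℝ} (G : ThermalData H θ)

/-- The integral kernel of the thermal state in the momentum representation. -/
def kernel (ξ η : Config N) : ℂ :=
  ∑' n, (G.weight n : ℂ) * (FT (G.basis n) ξ * conj (FT (G.basis n) η))

theorem measurable_mom (n : ℕ) : Measurable (FT (G.basis n)) :=
  (Lp.stronglyMeasurable _).measurable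

theorem measurable_kernel : Measurable fun p : Config N × Config N => G.kernel p.1 p.2 := by
  refine Measurable.tsum fun n => measurable_const.mul ?_
  exact ((G.measurable_mom n).comp measurable_fst).mul
    (Complex.continuous_conj.measurable.comp ((G.measurable_mom n).comp measurable_snd))

theorem norm_mom (n : ℕ) : ‖FT (G.basis n)‖ = 1 := by
  rw [LinearIsometryEquiv.norm_map, G.norm_basis]

theorem conj_kernel (ξ η : Config N) : conj (G.kernel ξ η) = G.kernel η ξ := by
  rw [kernel, Complex.conj_tsum]
  refine tsum_congr fun n => ?_
  simp [mul_comm]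

/-- The matrix elements of the thermal state as integrals against its kernel. -/
theorem inner_state_eq_integral {u v : Config N → ℂ} (hu : MemLp u 2 volume)
    (hv : MemLp v 2 volume) :
    Integrable (fun p : Config N × Config N => conj (u p.1) * v p.2 * G.kernel p.1 p.2)
      (volume.prod volume) ∧
    inner ℂ (FT.symm (hu.toLp u)) (G.state (FT.symm (hv.toLp v)))
      = ∫ p, conj (u p.1) * v p.2 * G.kernel p.1 p.2 ∂(volume.prod volume) := by
  set x := hu.toLp u with hx
  set y := hv.toLp v with hy
  set F : ℕ → Config N × Config N → ℂ := fun n p =>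
    (G.weight n : ℂ) * ((conj (x p.1) * FT (G.basis n) p.1) *
      (conj (FT (G.basis n) p.2) * y p.2)) with hF
  have hint : ∀ n, Integrable (F n) (volume.prod volume) := fun n =>
    ((integrable_conj_mul x (FT (G.basis n))).mul_prod
      (integrable_conj_mul (FT (G.basis n)) y)).const_mul _
  have hsum : Summable fun n => ∫ p, ‖F n p‖ ∂(volume.prod volume) := by
    refine Summable.of_nonneg_of_le (fun n => integral_nonneg fun _ => norm_nonneg _) (fun n => ?_)
      (G.summable_weight.mul_right ((‖x‖ ^ 2 + 1) / 2 * ((1 + ‖y‖ ^ 2) / 2)))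
    have e1 : ∀ p : Config N × Config N, ‖F n p‖ = G.weight n *
        (‖conj (x p.1) * FT (G.basis n) p.1‖ * ‖conj (FT (G.basis n) p.2) * y p.2‖) := fun p => by
      rw [hF]
      simp only [norm_mul, Complex.norm_real, Real.norm_of_nonneg (G.weight_pos n).le]
    simp_rw [e1]
    rw [integral_const_mul, integral_prod_mul (fun ξ => ‖conj (x ξ) * FT (G.basis n) ξ‖)
      (fun ξ => ‖conj (FT (G.basis n) ξ) * y ξ‖)]
    have h1 := integral_norm_conj_mul_le x (FT (G.basis n))
    have h2 := integral_norm_conj_mul_le (FT (G.basis n)) y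
    rw [G.norm_mom, one_pow] at h1 h2
    exact mul_le_mul_of_nonneg_left (mul_le_mul h1 h2 (integral_nonneg fun _ => norm_nonneg _)
      (by positivity)) (G.weight_pos n).le
  have hae : (fun p : Config N × Config N => ∑' n, F n p) =ᵐ[volume.prod volume]
      fun p => conj (u p.1) * v p.2 * G.kernel p.1 p.2 := by
    filter_upwards [Measure.quasiMeasurePreserving_fst.ae hu.coeFn_toLp,
      Measure.quasiMeasurePreserving_snd.ae hv.coeFn_toLp] with p h1 h2
    rw [kernel, ← tsum_mul_left]
    refine tsum_congr fun n => ?_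
    rw [hF]
    simp only [hx, hy, h1, h2]
    ring
  refine ⟨(integrable_tsum_of_summable hint hsum).congr hae, ?_⟩
  rw [← integral_congr_ae hae]
  refine (G.hasSum_inner_state _ _).unique
    ((hasSum_integral_of_summable_integral_norm hint hsum).congr_fun fun n => ?_)
  rw [integral_const_mul, integral_prod_mul (fun ξ => conj (x ξ) * FT (G.basis n) ξ)
    (fun ξ => conj (FT (G.basis n) ξ) * y ξ), ← inner_hilb, ← inner_hilb, ← inner_FT,
    ← inner_FT (G.basis n), LinearIsometryEquiv.apply_symm_apply,
    LinearIsometryEquiv.apply_symm_apply]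

end ThermalData

/-! ### The Wigner function in the momentum representation -/

theorem Config.measurePreserving_sub_left (a : Config N) :
    MeasurePreserving (fun w : Config N => a - w) volume volume :=
  Measure.measurePreserving_sub_left volume a

/-- The reflection `ψ(w) ↦ ψ(a - w)`. -/
def reflect (a : Config N) : Hilb N →ₗᵢ[ℂ] Hilb N :=
  Lp.compMeasurePreservingₗᵢ ℂ (fun w => a - w) (Config.measurePreserving_sub_left a)

theorem reflect_coe (a : Config N) (ψ : Hilb N) :
    reflect a ψ =ᵐ[volume] fun w => ψ (a - w) :=
  Lp.coeFn_compMeasurePreserving ψ (Config.measurePreserving_sub_left a)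

/-- The unitary operator `phase κ`, bundled as a linear isometry. -/
def phaseₗᵢ (κ : Config N) : Hilb N →ₗᵢ[ℂ] Hilb N where
  toLinearMap := phase κ
  norm_map' := norm_phase κ

theorem exists_schwartz_reflect (a : Config N) (s : 𝓢(Config N, ℂ)) :
    ∃ t : 𝓢(Config N, ℂ), (∀ w, t w = s (a - w)) ∧ t.toLp 2 = reflect a (s.toLp 2) := by
  refine ⟨shift a (compCLMOfContinuousLinearEquiv ℂ (ContinuousLinearEquiv.neg ℝ) s), ?_, ?_⟩
  · intro w
    simp [compSubConstCLM_apply]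
  · refine Lp.ext ?_
    filter_upwards [(shift a (compCLMOfContinuousLinearEquiv ℂ
      (ContinuousLinearEquiv.neg ℝ) s)).coeFn_toLp 2, reflect_coe a (s.toLp 2),
      (Config.measurePreserving_sub_left a).quasiMeasurePreserving.ae
        (s.coeFn_toLp 2 volume)]
      with w h1 h2 h3
    rw [h1, h2, h3]
    simp [compSubConstCLM_apply]

/-- A modulated reflection is a parity displaced in phase space. The Fourier transform exchanges the
centre of reflection and the modulation, up to a phase, as the substitution `w ↦ a - w` in the
Fourier integral shows. -/
theorem FT_phase_reflect_toLp (a b : Config N) (s : 𝓢(Config N, ℂ)) :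
    FT (phase (-(2 * Real.pi) • b) (reflect a (s.toLp 2))) =
      Complex.exp (2 * Real.pi * (inner ℝ a b : ℝ) * Complex.I) •
        phase ((2 * Real.pi) • a) (reflect b (FT (s.toLp 2))) := by
  obtain ⟨t, ht, hta⟩ := exists_schwartz_reflect a s
  rw [← hta, ← vec_fourier, phase_two_pi_vec, FT_vec, ← vec_fourier s, FT_vec]
  refine Lp.ext ?_
  filter_upwards [(shift b (𝓕 t)).coeFn_toLp 2,
    Lp.coeFn_smul (Complex.exp (2 * Real.pi * (inner ℝ a b : ℝ) * Complex.I))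
      (phase ((2 * Real.pi) • a) (reflect b ((𝓕 s).toLp 2))),
    phase_coe ((2 * Real.pi) • a) (reflect b ((𝓕 s).toLp 2)), reflect_coe b ((𝓕 s).toLp 2),
    (Config.measurePreserving_sub_left b).quasiMeasurePreserving.ae
      ((𝓕 s).coeFn_toLp 2 volume)]
    with ν h1 h2 h3 h4 h5
  rw [h1, h2, Pi.smul_apply, h3, h4, h5, compSubConstCLM_apply, SchwartzMap.fourier_coe,
    SchwartzMap.fourier_coe, Real.fourier_eq', Real.fourier_eq', smul_eq_mul, ← mul_assoc,
    ← Complex.exp_add, ← integral_const_mul, ← integral_sub_left_eq_self _ volume a]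
  refine integral_congr_ae (Eventually.of_forall fun w => ?_)
  simp only [ht, smul_eq_mul, ← mul_assoc, ← Complex.exp_add, sub_sub_cancel]
  congr 2
  simp only [inner_sub_left, inner_sub_right, inner_smul_left, conj_trivial]
  push_cast
  ring

theorem FT_phase_reflect (a b : Config N) (ψ : Hilb N) :
    FT (phase (-(2 * Real.pi) • b) (reflect a ψ)) =
      Complex.exp (2 * Real.pi * (inner ℝ a b : ℝ) * Complex.I) •
        phase ((2 * Real.pi) • a) (reflect b (FT ψ)) := by
  have h1 : Continuous fun ψ : Hilb N => FT (phaseₗᵢ (-(2 * Real.pi) • b) (reflect a ψ)) :=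
    FT.continuous.comp ((phaseₗᵢ _).continuous.comp (reflect a).continuous)
  have h2 : Continuous fun ψ : Hilb N => phaseₗᵢ ((2 * Real.pi) • a) (reflect b (FT ψ)) :=
    (phaseₗᵢ _).continuous.comp ((reflect b).continuous.comp FT.continuous)
  refine (denseRange_toLpCLM (E := Config N) (F := ℂ) (p := 2) (μ := volume)
    ENNReal.ofNat_ne_top).induction_on ψ (isClosed_eq h1
      (h2.const_smul (Complex.exp (2 * Real.pi * (inner ℝ a b : ℝ) * Complex.I)))) fun s => ?_
  exact FT_phase_reflect_toLp a b s

/-- The Wigner function of a pure state in the momentum representation. -/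
theorem integral_wigner (ψ : Hilb N) (x ξ : Config N) :
    ∫ w, Complex.exp (-(2 * Real.pi * (inner ℝ ((2 : ℝ) • ξ) (w - x) : ℝ)) * Complex.I) *
        (ψ w * conj (ψ ((2 : ℝ) • x - w))) =
      ∫ ν, Complex.exp (2 * Real.pi * (inner ℝ (ν - ξ) ((2 : ℝ) • x) : ℝ) * Complex.I) *
        (FT ψ ν * conj (FT ψ ((2 : ℝ) • ξ - ν))) := by
  -- Up to a phase, the Wigner integral is the inner product of `ψ` with its displaced parity, so
  -- unitarity carries it to momentum space for every `ψ` in `L²`.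
  have h := inner_FT (phase (-(2 * Real.pi) • ((2 : ℝ) • ξ)) (reflect ((2 : ℝ) • x) ψ)) ψ
  rw [FT_phase_reflect, inner_smul_left, inner_hilb, inner_hilb] at h
  have hl : ∫ w, Complex.exp (-(2 * Real.pi * (inner ℝ ((2 : ℝ) • ξ) (w - x) : ℝ)) * Complex.I) *
        (ψ w * conj (ψ ((2 : ℝ) • x - w))) =
      Complex.exp (2 * Real.pi * (inner ℝ ((2 : ℝ) • ξ) x : ℝ) * Complex.I) *
        ∫ w, conj (phase (-(2 * Real.pi) • ((2 : ℝ) • ξ)) (reflect ((2 : ℝ) • x) ψ) w) * ψ w := by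
    rw [← integral_const_mul]
    refine integral_congr_ae ?_
    filter_upwards [phase_coe (-(2 * Real.pi) • ((2 : ℝ) • ξ)) (reflect ((2 : ℝ) • x) ψ),
      reflect_coe ((2 : ℝ) • x) ψ] with w h1 h2
    rw [h1, h2, map_mul, ← Complex.exp_conj, mul_comm (ψ w), ← mul_assoc, ← mul_assoc,
      ← mul_assoc, ← Complex.exp_add]
    congr 3
    simp only [map_mul, map_neg, Complex.conj_I, Complex.conj_ofReal, inner_sub_right,
      inner_smul_left, conj_trivial]
    push_cast
    ring
  rw [hl, ← h, ← mul_assoc, ← integral_const_mul]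
  refine integral_congr_ae ?_
  filter_upwards [phase_coe ((2 * Real.pi) • ((2 : ℝ) • x)) (reflect ((2 : ℝ) • ξ) (FT ψ)),
      reflect_coe ((2 : ℝ) • ξ) (FT ψ)] with w h1 h2
  rw [h1, h2, map_mul, ← Complex.exp_conj, ← Complex.exp_conj, ← Complex.exp_add, ← mul_assoc,
    ← mul_assoc, ← Complex.exp_add, mul_comm (FT ψ w), ← mul_assoc]
  congr 3
  simp only [map_mul, map_neg, Complex.conj_I, Complex.conj_ofReal, inner_sub_left,
    inner_smul_left, inner_smul_right, conj_trivial, Complex.conj_ofNat,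
    real_inner_comm x ξ, real_inner_comm x w]
  push_cast
  ring

/-! ### Almost everywhere Fourier inversion for integrable functions. -/

theorem integral_fourier_mul {u v : Config N → ℂ} (hu : Integrable u volume)
    (hv : Integrable v volume) : ∫ ξ, 𝓕 u ξ * v ξ = ∫ ξ, u ξ * 𝓕 v ξ := by
  have := VectorFourier.integral_fourierIntegral_smul_eq_flip (μ := volume) (ν := volume)
    (L := innerₗ (Config N)) Real.continuous_fourierChar continuous_inner hu hv
  simp only [flip_innerₗ] at this
  exact this

theorem continuous_fourier {u : Config N → ℂ} (hu : Integrable u volume) : Continuous (𝓕 u) :=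
  VectorFourier.fourierIntegral_continuous Real.continuous_fourierChar continuous_inner hu

theorem continuous_fourierInv {u : Config N → ℂ} (hu : Integrable u volume) :
    Continuous (𝓕⁻ u) := by
  rw [Real.fourierInv_eq_fourier_comp_neg]
  exact continuous_fourier hu.comp_neg

theorem integral_schwartz_mul_fourierInv (s : 𝓢(Config N, ℂ)) {u : Config N → ℂ}
    (hu : Integrable u volume) : ∫ x, s x * 𝓕⁻ u x = ∫ x, 𝓕⁻ (⇑s) x * u x := by
  calc ∫ x, s x * 𝓕⁻ u x = ∫ x, s (-x) * 𝓕 u x := by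
        rw [← integral_neg_eq_self]
        simp only [Real.fourierInv_eq_fourier_neg, neg_neg]
    _ = ∫ x, 𝓕 (fun x => s (-x)) x * u x := (integral_fourier_mul s.integrable.comp_neg hu).symm
    _ = ∫ x, 𝓕⁻ (⇑s) x * u x := by rw [← Real.fourierInv_eq_fourier_comp_neg]

/-- Almost everywhere equality of locally integrable functions can be tested on real-valued
Schwartz functions. -/
theorem ae_eq_of_schwartz {u v : Config N → ℂ} (hu : LocallyIntegrable u volume)
    (hv : LocallyIntegrable v volume)
    (h : ∀ s : 𝓢(Config N, ℂ), HasCompactSupport s → (∀ x, conj (s x) = s x) →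
      ∫ x, s x * u x = ∫ x, s x * v x) : u =ᵐ[volume] v := by
  refine ae_eq_of_integral_contDiff_smul_eq hu hv fun g hg hc => ?_
  have hg1 : HasCompactSupport fun x => (g x : ℂ) := hc.comp_left Complex.ofReal_zero
  have hg2 : ContDiff ℝ ∞ fun x => (g x : ℂ) := Complex.ofRealCLM.contDiff.comp hg
  simp only [Complex.real_smul]
  exact h (hg1.toSchwartzMap hg2) hg1 fun x => Complex.conj_ofReal (g x)

/-- Fourier inversion for integrable functions with integrable transform, almost everywhere. -/
theorem fourier_fourierInv_ae {h : Config N → ℂ} (hi : Integrable h volume)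
    (hi' : Integrable (𝓕⁻ h) volume) : 𝓕 (𝓕⁻ h) =ᵐ[volume] h := by
  refine ae_eq_of_schwartz (continuous_fourier hi').locallyIntegrable hi.locallyIntegrable
    fun s _ _ => ?_
  rw [← integral_fourier_mul s.integrable hi', ← SchwartzMap.fourier_coe,
    integral_schwartz_mul_fourierInv _ hi, ← SchwartzMap.fourierInv_coe,
    FourierTransform.fourierInv_fourier_eq]

/-- The substitution `w = x + y/2` turns the definition into the integral of `integral_wigner`; its
Jacobian is the factor `|((1/2)^N)⁻¹| = 2^N`. -/
theorem wignerPure_eq {ħ : ℝ} (hħ : 0 < ħ) (ψ : Hilb N) (x ξ : Config N) :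
    wignerPure ħ ψ ((2 * Real.pi * ħ) • ξ) x =
      ((((2 * Real.pi * ħ) ^ N)⁻¹ * |((1 / 2 : ℝ) ^ N)⁻¹| : ℝ) : ℂ) *
      ∫ ν, Complex.exp (2 * Real.pi * (inner ℝ (ν - ξ) ((2 : ℝ) • x) : ℝ) * Complex.I) *
        (FT ψ ν * conj (FT ψ ((2 : ℝ) • ξ - ν))) := by
  rw [wignerPure, ← integral_wigner, ← integral_add_left_eq_self (fun w => Complex.exp
    (-(2 * Real.pi * (inner ℝ ((2 : ℝ) • ξ) (w - x) : ℝ)) * Complex.I) *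
      (ψ w * conj (ψ ((2 : ℝ) • x - w)))) x, Complex.ofReal_mul,
    mul_assoc (Complex.ofReal _)]
  congr 1
  have h := Measure.integral_comp_smul (volume : Measure (Config N)) (fun w =>
    Complex.exp (-(2 * Real.pi * (inner ℝ ((2 : ℝ) • ξ) (x + w - x) : ℝ)) * Complex.I) *
        (ψ (x + w) * conj (ψ ((2 : ℝ) • x - (x + w))))) (1 / 2)
  rw [finrank_euclideanSpace_fin, Complex.real_smul] at h
  rw [← h]
  refine integral_congr_ae (Eventually.of_forall fun y => ?_)
  simp only []
  congr 2
  · rw [add_sub_cancel_left, inner_smul_left, inner_smul_left, inner_smul_right]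
    simp only [conj_trivial]
    push_cast
    field_simp
  · have e : (2 : ℝ) • x - (x + (1 / 2 : ℝ) • y) = x - (1 / 2 : ℝ) • y := by
      rw [two_smul]; abel
    rw [e]
    rfl

/-! ### The Blokhintsev function as the momentum kernel, and positivity of the kernel. -/

namespace ThermalData

variable {H : Hilb N →ₗ.[ℂ] Hilb N} {θ : ℝ} (G : ThermalData H θ)

theorem integrable_mom_reflect (n : ℕ) (ξ : Config N) :
    Integrable (fun ν => FT (G.basis n) ν * conj (FT (G.basis n) ((2 : ℝ) • ξ - ν))) volume ∧
    ∫ ν, ‖FT (G.basis n) ν * conj (FT (G.basis n) ((2 : ℝ) • ξ - ν))‖ ≤ 1 := by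
  have hae : (fun ν => conj (reflect ((2 : ℝ) • ξ) (FT (G.basis n)) ν) * FT (G.basis n) ν)
      =ᵐ[volume] fun ν => FT (G.basis n) ν * conj (FT (G.basis n) ((2 : ℝ) • ξ - ν)) := by
    filter_upwards [reflect_coe ((2 : ℝ) • ξ) (FT (G.basis n))] with ν h
    rw [h, mul_comm]
  refine ⟨(integrable_conj_mul _ _).congr hae, ?_⟩
  refine (integral_congr_ae (hae.symm.fun_comp norm)).trans_le
    ((integral_norm_conj_mul_le _ _).trans_eq ?_)
  rw [LinearIsometry.norm_map, G.norm_mom]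
  norm_num

/-- The `n`-th term has `L¹` norm at most its weight, so integrability holds for every `ξ` and not
only for almost every one. -/
theorem integrable_kernel_reflect (ξ : Config N) :
    Integrable (fun ν => G.kernel ν ((2 : ℝ) • ξ - ν)) volume := by
  refine integrable_tsum_of_summable (fun n => (G.integrable_mom_reflect n ξ).1.const_mul _) ?_
  refine Summable.of_nonneg_of_le (fun n => integral_nonneg fun _ => norm_nonneg _) (fun n => ?_)
    G.summable_weight
  simp_rw [norm_mul (G.weight n : ℂ), Complex.norm_real, Real.norm_of_nonneg (G.weight_pos n).le]
  rw [integral_const_mul]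
  exact mul_le_of_le_one_right (G.weight_pos n).le (G.integrable_mom_reflect n ξ).2

/-- The Wigner function of the thermal state in terms of its momentum kernel. -/
theorem wigner_eq {ħ : ℝ} (hħ : 0 < ħ) (x ξ : Config N) :
    wigner ħ G ((2 * Real.pi * ħ) • ξ) x =
      ((((2 * Real.pi * ħ) ^ N)⁻¹ * |((1 / 2 : ℝ) ^ N)⁻¹| : ℝ) : ℂ) *
        (Complex.exp (-(2 * Real.pi * (inner ℝ ξ ((2 : ℝ) • x) : ℝ)) * Complex.I) *
        𝓕⁻ (fun ν => G.kernel ν ((2 : ℝ) • ξ - ν)) ((2 : ℝ) • x)) := by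
  set F : ℕ → Config N → ℂ := fun n ν => (G.weight n : ℂ) *
    (Complex.exp (2 * Real.pi * (inner ℝ (ν - ξ) ((2 : ℝ) • x) : ℝ) * Complex.I) *
        (FT (G.basis n) ν * conj (FT (G.basis n) ((2 : ℝ) • ξ - ν)))) with hF
  have hnorm : ∀ n ν, ‖F n ν‖ =
      G.weight n * ‖FT (G.basis n) ν * conj (FT (G.basis n) ((2 : ℝ) • ξ - ν))‖ := fun n ν => by
    rw [hF]
    simp only []
    rw [norm_mul, norm_mul (Complex.exp _), Complex.norm_real,
      Real.norm_of_nonneg (G.weight_pos n).le, ← Complex.ofReal_ofNat, ← Complex.ofReal_mul,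
      ← Complex.ofReal_mul, Complex.norm_exp_ofReal_mul_I, one_mul]
  have hint : ∀ n, Integrable (F n) volume := fun n => by
    refine ((G.integrable_mom_reflect n ξ).1.const_mul (G.weight n : ℂ)).mono ?_ ?_
    · exact ((Continuous.aestronglyMeasurable (by fun_prop)).mul
        (G.integrable_mom_reflect n ξ).1.aestronglyMeasurable).const_mul _
    · refine Eventually.of_forall fun ν => ?_
      rw [hnorm, norm_mul (G.weight n : ℂ), Complex.norm_real,
        Real.norm_of_nonneg (G.weight_pos n).le]
  have hsum : Summable fun n => ∫ ν, ‖F n ν‖ := by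
    refine Summable.of_nonneg_of_le (fun n => integral_nonneg fun _ => norm_nonneg _)
      (fun n => ?_) G.summable_weight
    simp_rw [hnorm]
    rw [integral_const_mul]
    exact mul_le_of_le_one_right (G.weight_pos n).le (G.integrable_mom_reflect n ξ).2
  have hs := (hasSum_integral_of_summable_integral_norm hint hsum).tsum_eq
  have hw : ∀ n, (G.weight n : ℂ) * wignerPure ħ (G.basis n) ((2 * Real.pi * ħ) • ξ) x =
      ((((2 * Real.pi * ħ) ^ N)⁻¹ * |((1 / 2 : ℝ) ^ N)⁻¹| : ℝ) : ℂ) * ∫ ν, F n ν := fun n => by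
    rw [wignerPure_eq hħ, hF, integral_const_mul]
    ring
  rw [wigner]
  simp_rw [hw]
  rw [tsum_mul_left, hs, Real.fourierInv_eq']
  congr 1
  rw [← integral_const_mul]
  refine integral_congr_ae (Eventually.of_forall fun ν => ?_)
  simp only [hF, kernel, smul_eq_mul]
  rw [← mul_assoc, ← Complex.exp_add, ← tsum_mul_left]
  refine tsum_congr fun n => ?_
  rw [mul_left_comm]
  congr 3
  rw [inner_sub_left]
  push_cast
  ring

/-- Formally the two transforms cancel and leave `G.kernel` at `(ξ - l/4π, ξ + l/4π)`. Cancelling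
them needs integrability of the inner transform, which is not assumed here. -/
theorem blokhintsev_eq {ħ : ℝ} (hħ : 0 < ħ) (ξ l : Config N) :
    blokhintsev ħ G ((2 * Real.pi * ħ) • ξ) l =
      ((((2 * Real.pi * ħ) ^ N)⁻¹ * |((1 / 2 : ℝ) ^ N)⁻¹| * |((2 : ℝ) ^ N)⁻¹| : ℝ) : ℂ) *
        𝓕 (𝓕⁻ (fun ν => G.kernel ν ((2 : ℝ) • ξ - ν))) (ξ - (4 * Real.pi)⁻¹ • l) := by
  have h := Measure.integral_comp_smul (volume : Measure (Config N)) (fun x =>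
    Complex.exp (((-2 * Real.pi * inner ℝ x (ξ - (4 * Real.pi)⁻¹ • l) : ℝ) : ℂ) * Complex.I) *
      𝓕⁻ (fun ν => G.kernel ν ((2 : ℝ) • ξ - ν)) x) 2
  rw [finrank_euclideanSpace_fin, Complex.real_smul] at h
  rw [blokhintsev, Real.fourier_eq', Complex.ofReal_mul, mul_assoc (Complex.ofReal _)]
  simp_rw [smul_eq_mul]
  rw [← h, ← integral_const_mul]
  refine integral_congr_ae (Eventually.of_forall fun x => ?_)
  simp only []
  rw [G.wigner_eq hħ, mul_left_comm, ← mul_assoc (Complex.exp _), ← Complex.exp_add]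
  congr 3
  simp only [inner_sub_right, inner_smul_left, inner_smul_right, conj_trivial,
    real_inner_comm x l, real_inner_comm x ξ]
  push_cast
  field_simp
  ring

theorem kernel_reflect_pos {ħ : ℝ} (hħ : 0 < ħ)
    (hpos : ∀ p l : Config N, 0 < blokhintsev ħ G p l) (ξ : Config N) :
    ∀ᵐ ν, 0 < G.kernel ν ((2 : ℝ) • ξ - ν) := by
  set c : ℝ := ((2 * Real.pi * ħ) ^ N)⁻¹ * |((1 / 2 : ℝ) ^ N)⁻¹| with hc
  have hc0 : 0 < c := by positivity
  have hc1 : 0 < c * |((2 : ℝ) ^ N)⁻¹| := by positivity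
  have hi' : Integrable (𝓕⁻ (fun ν => G.kernel ν ((2 : ℝ) • ξ - ν))) volume := by
    have h1 : Integrable (fun x => Complex.exp (Complex.I * ((inner ℝ (0 : Config N) x : ℝ) : ℂ)) *
        wigner ħ G ((2 * Real.pi * ħ) • ξ) x) volume := by
      -- If `W` were not integrable, the integral defining `B_θ` would have the default value `0`,
      -- against positivity. Thus positivity also supplies the integrability that Fourier inversion
      -- needs.
      by_contra hn
      exact (hpos ((2 * Real.pi * ħ) • ξ) 0).ne' (integral_undef hn)
    rw [← integrable_comp_smul_iff volume _ (two_ne_zero (α := ℝ)), ← integrable_norm_iff]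
    · refine (h1.norm.const_mul c⁻¹).congr (Eventually.of_forall fun x => ?_)
      simp only []
      rw [G.wigner_eq hħ, norm_mul, norm_mul, norm_mul, ← hc, Complex.norm_real,
        Real.norm_of_nonneg hc0.le, ← Complex.ofReal_ofNat, ← Complex.ofReal_mul,
        ← Complex.ofReal_mul, ← Complex.ofReal_neg, Complex.norm_exp_ofReal_mul_I]
      rw [inner_zero_left, Complex.ofReal_zero, mul_zero, Complex.exp_zero, norm_one, one_mul,
        one_mul, ← mul_assoc, inv_mul_cancel₀ hc0.ne', one_mul]
    · refine Continuous.aestronglyMeasurable ?_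
      exact (continuous_fourierInv (G.integrable_kernel_reflect ξ)).comp
        (continuous_const_smul _)
  filter_upwards [fourier_fourierInv_ae (G.integrable_kernel_reflect ξ) hi'] with ν hν
  rw [← hν]
  -- This `l` is chosen so that `ξ - l/(4π) = ν`.
  have h := hpos ((2 * Real.pi * ħ) • ξ) ((4 * Real.pi) • (ξ - ν))
  rw [G.blokhintsev_eq hħ, smul_smul, inv_mul_cancel₀ (by positivity), one_smul,
    sub_sub_cancel] at h
  exact pos_of_mul_pos_right h (Complex.zero_le_real.2 hc1.le)

theorem measurableSet_pos : MeasurableSet {z : ℂ | 0 < z} := by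
  have : {z : ℂ | 0 < z} = {z : ℂ | 0 < z.re} ∩ {z | 0 = z.im} := by
    ext z; exact Complex.lt_def
  rw [this]
  exact (measurableSet_lt measurable_const Complex.measurable_re).inter
    (measurableSet_eq_fun measurable_const Complex.measurable_im)

/-- Positivity of the Blokhintsev function makes the momentum kernel positive almost
everywhere. -/
theorem kernel_pos {ħ : ℝ} (hħ : 0 < ħ)
    (hpos : ∀ p l : Config N, 0 < blokhintsev ħ G p l) :
    ∀ᵐ p ∂((volume : Measure (Config N)).prod (volume : Measure (Config N))),
      0 < G.kernel p.1 p.2 := by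
  have h1 : ∀ᵐ ξ : Config N, ∀ᵐ ν : Config N, 0 < G.kernel ν ((2 : ℝ) • ξ - ν) :=
    Eventually.of_forall (G.kernel_reflect_pos hħ hpos)
  have hm : MeasurableSet {p : Config N × Config N | 0 < G.kernel p.1 p.2} :=
    G.measurable_kernel measurableSet_pos
  have hm' : MeasurableSet
      {p : Config N × Config N | 0 < G.kernel p.2 ((2 : ℝ) • p.1 - p.2)} := by
    have hf : Measurable fun p : Config N × Config N => (p.2, (2 : ℝ) • p.1 - p.2) := by fun_prop
    exact hf hm
  rw [Measure.ae_ae_comm (p := fun ξ ν => 0 < G.kernel ν ((2 : ℝ) • ξ - ν)) hm'] at h1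
  rw [Measure.ae_prod_iff_ae_ae hm]
  filter_upwards [h1] with ν hν
  -- For fixed `ν` the midpoint `ξ = (η + ν)/2` satisfies `2ξ - ν = η`, and this affine substitution
  -- preserves null sets.
  have hq : Measure.QuasiMeasurePreserving (fun η : Config N => (2⁻¹ : ℝ) • (η + ν))
      volume volume := by
    refine Measure.QuasiMeasurePreserving.comp (g := fun η : Config N => (2⁻¹ : ℝ) • η)
      ⟨measurable_const_smul _, ?_⟩
      (measurePreserving_add_right volume ν).quasiMeasurePreserving
    rw [Measure.map_addHaar_smul _ (by norm_num)]
    exact Measure.smul_absolutelyContinuous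
  filter_upwards [hq.ae hν] with η hη
  rwa [smul_smul, mul_inv_cancel₀ two_ne_zero, one_smul, add_sub_cancel_right] at hη

end ThermalData

/-! ### Matrix elements along orbits of momentum translations -/

/-- On `L¹ ∩ L²`, the unitary Fourier transform is given by the Fourier integral. -/
theorem FT_symm_ae {u : Config N → ℂ} (h1 : Integrable u volume) (h2 : MemLp u 2 volume) :
    FT.symm (h2.toLp u) =ᵐ[volume] 𝓕⁻ u := by
  refine ae_eq_of_schwartz ((Lp.memLp _).locallyIntegrable (by norm_num))
    (continuous_fourierInv h1).locallyIntegrable fun s _ hs => ?_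
  rw [integral_schwartz_mul_fourierInv s h1]
  have e1 : ∫ x, s x * FT.symm (h2.toLp u) x = inner ℂ (s.toLp 2) (FT.symm (h2.toLp u)) := by
    rw [inner_hilb]
    refine integral_congr_ae ?_
    filter_upwards [s.coeFn_toLp 2] with x hx
    rw [hx, hs]
  rw [e1, ← inner_FT, LinearIsometryEquiv.apply_symm_apply, ← vec_fourier, FT_vec, inner_hilb]
  refine integral_congr_ae ?_
  filter_upwards [(𝓕 s).coeFn_toLp 2, h2.coeFn_toLp] with x h3 h4
  rw [h3, h4]
  congr 1
  rw [SchwartzMap.fourier_coe, Real.fourier_eq', Real.fourierInv_eq', ← integral_conj]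
  refine integral_congr_ae (Eventually.of_forall fun y => ?_)
  simp only [smul_eq_mul, map_mul, hs, ← Complex.exp_conj, Complex.conj_I, Complex.conj_ofReal]
  congr 2
  push_cast
  ring

/-- As functions of the translation `c`, matrix elements are Fourier transforms of integrable
functions. Continuity, decay at infinity (Riemann–Lebesgue) and square integrability (Plancherel)
along the orbit all follow from this. -/
theorem inner_phase_eq_fourierInv (h ψ : Hilb N) (c : Config N) :
    inner ℂ h (phase (-(2 * Real.pi) • c) ψ) = 𝓕⁻ (fun x => conj (h x) * ψ x) c := by
  rw [inner_hilb, Real.fourierInv_eq']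
  refine integral_congr_ae ?_
  filter_upwards [phase_coe (-(2 * Real.pi) • c) ψ] with x hx
  rw [hx, smul_eq_mul, mul_left_comm]
  congr 2
  rw [inner_smul_left, real_inner_comm]
  simp only [conj_trivial]
  push_cast
  ring

theorem continuous_inner_phase (h ψ : Hilb N) :
    Continuous fun c : Config N => inner ℂ h (phase (-(2 * Real.pi) • c) ψ) := by
  simp_rw [inner_phase_eq_fourierInv]
  exact continuous_fourierInv (integrable_conj_mul h ψ)

theorem tendsto_inner_phase (h ψ : Hilb N) :
    Tendsto (fun c : Config N => inner ℂ h (phase (-(2 * Real.pi) • c) ψ))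
      (cocompact (Config N)) (𝓝 0) := by
  simp_rw [inner_phase_eq_fourierInv, Real.fourierInv_eq_fourier_neg]
  exact (tendsto_integral_exp_inner_smul_cocompact fun x => conj (h x) * ψ x).comp
    (Homeomorph.neg (Config N)).isClosedEmbedding.tendsto_cocompact

theorem norm_inner_phase_le (h ψ : Hilb N) (κ : Config N) :
    ‖inner ℂ h (phase κ ψ)‖ ^ 2 ≤ ‖h‖ ^ 2 * ‖ψ‖ ^ 2 := by
  rw [← mul_pow]
  refine pow_le_pow_left₀ (norm_nonneg _) ((norm_inner_le_norm _ _).trans_eq ?_) 2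
  rw [norm_phase]

/-- Plancherel applied to `conj h · s`, with `C` the square of a bound for `|s|`. Uniformity of `C`
in `h` allows summation over the eigenvectors. -/
theorem integrable_inner_phase_sq (s : 𝓢(Config N, ℂ)) :
    ∃ C, ∀ h : Hilb N,
      Integrable (fun c : Config N => ‖inner ℂ h (phase (-(2 * Real.pi) • c) (s.toLp 2))‖ ^ 2)
        volume ∧
      ∫ c : Config N, ‖inner ℂ h (phase (-(2 * Real.pi) • c) (s.toLp 2))‖ ^ 2 ≤ C * ‖h‖ ^ 2 := by
  obtain ⟨C, hC⟩ : ∃ C, ∀ x, ‖s x‖ ≤ C :=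
    ⟨‖s.toBoundedContinuousFunction‖, fun x => s.toBoundedContinuousFunction.norm_coe_le_norm x⟩
  refine ⟨C ^ 2, fun h => ?_⟩
  have hle : ∀ᵐ x, ‖conj (h x) * (s.toLp 2) x‖ ≤ C * ‖h x‖ := by
    filter_upwards [s.coeFn_toLp 2] with x hx
    rw [hx, norm_mul, RCLike.norm_conj, mul_comm]
    exact mul_le_mul_of_nonneg_right (hC x) (norm_nonneg _)
  have h2 : MemLp (fun x => conj (h x) * (s.toLp 2) x) 2 volume :=
    (Lp.memLp h).of_le_mul (integrable_conj_mul h _).aestronglyMeasurable hle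
  have hae : (fun c => ‖FT.symm (h2.toLp _) c‖ ^ 2) =ᵐ[volume]
      fun c => ‖inner ℂ h (phase (-(2 * Real.pi) • c) (s.toLp 2))‖ ^ 2 := by
    filter_upwards [FT_symm_ae (integrable_conj_mul h _) h2] with c hc
    rw [hc, inner_phase_eq_fourierInv]
  refine ⟨(integrable_norm_sq _).congr hae, ?_⟩
  rw [← integral_congr_ae hae, integral_norm_sq, LinearIsometryEquiv.norm_map, ← mul_pow]
  refine pow_le_pow_left₀ (norm_nonneg _) (Lp.norm_le_mul_norm_of_ae_le_mul ?_) 2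
  filter_upwards [h2.coeFn_toLp, hle] with x h3 h4
  rwa [h3]

/-- The weighted sum `∑ₙ wₙ |⟨hₙ, ψ_c⟩|²` along the orbit `c ↦ ψ_c` of momentum translations. -/
def orbitSum (w : ℕ → ℝ) (h : ℕ → Hilb N) (ψ : Hilb N) (c : Config N) : ℝ :=
  ∑' n, w n * ‖inner ℂ (h n) (phase (-(2 * Real.pi) • c) ψ)‖ ^ 2

theorem orbitSum_term_le {w : ℕ → ℝ} {h : ℕ → Hilb N} (hw : ∀ n, 0 ≤ w n) (ψ : Hilb N)
    (n : ℕ) (c : Config N) :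
    ‖w n * ‖inner ℂ (h n) (phase (-(2 * Real.pi) • c) ψ)‖ ^ 2‖ ≤ w n * ‖h n‖ ^ 2 * ‖ψ‖ ^ 2 := by
  rw [Real.norm_of_nonneg (mul_nonneg (hw n) (sq_nonneg _)), mul_assoc]
  exact mul_le_mul_of_nonneg_left (norm_inner_phase_le _ _ _) (hw n)

theorem continuous_orbitSum {w : ℕ → ℝ} {h : ℕ → Hilb N} (hw : ∀ n, 0 ≤ w n)
    (hs : Summable fun n => w n * ‖h n‖ ^ 2) (ψ : Hilb N) : Continuous (orbitSum w h ψ) :=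
  continuous_tsum (fun n => continuous_const.mul ((continuous_inner_phase (h n) ψ).norm.pow 2))
    (hs.mul_right (‖ψ‖ ^ 2)) fun n c => orbitSum_term_le hw ψ n c

theorem tendsto_orbitSum {w : ℕ → ℝ} {h : ℕ → Hilb N} (hw : ∀ n, 0 ≤ w n)
    (hs : Summable fun n => w n * ‖h n‖ ^ 2) (ψ : Hilb N) :
    Tendsto (orbitSum w h ψ) (cocompact (Config N)) (𝓝 0) := by
  have key : Tendsto (orbitSum w h ψ) (cocompact (Config N)) (𝓝 (∑' _ : ℕ, (0 : ℝ))) := by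
    refine tendsto_tsum_of_dominated_convergence (hs.mul_right (‖ψ‖ ^ 2)) (fun n => ?_)
      (Eventually.of_forall fun c n => orbitSum_term_le hw ψ n c)
    simpa using ((tendsto_inner_phase (h n) ψ).norm.pow 2).const_mul (w n)
  simpa using key

theorem integrable_orbitSum {w : ℕ → ℝ} {h : ℕ → Hilb N} (hw : ∀ n, 0 ≤ w n)
    (hs : Summable fun n => w n * ‖h n‖ ^ 2) (s : 𝓢(Config N, ℂ)) :
    Integrable (orbitSum w h (s.toLp 2)) volume := by
  obtain ⟨C, hC⟩ := integrable_inner_phase_sq s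
  refine integrable_tsum_of_summable (fun n => ((hC (h n)).1.const_mul _)) ?_
  refine Summable.of_nonneg_of_le (fun n => integral_nonneg fun _ => norm_nonneg _) (fun n => ?_)
    (hs.mul_left C)
  simp_rw [Real.norm_of_nonneg (mul_nonneg (hw n) (sq_nonneg _))]
  rw [integral_const_mul, mul_left_comm]
  exact mul_le_mul_of_nonneg_left (hC (h n)).2 (hw n)

section

/-! ### The operators of the master equation on momentum-space test functions -/

theorem memLp_two_of_four {a : Config N → ℂ}
    (ha : ∀ S : Set (Config N), IsCompact S → MemLp a 4 (volume.restrict S))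
    (S : Set (Config N)) (hS : IsCompact S) : MemLp a 2 (volume.restrict S) := by
  have : IsFiniteMeasure (volume.restrict S) := ⟨by
    rw [Measure.restrict_apply_univ]; exact hS.measure_lt_top⟩
  exact (ha S hS).mono_exponent (by norm_num)

/-- This is the use of `L⁴_loc`: it puts `|f|²`, hence `A†A` on compactly supported test functions,
in `L²`. -/
theorem memLp_conj_mul_self {a : Config N → ℂ}
    (ha : ∀ S : Set (Config N), IsCompact S → MemLp a 4 (volume.restrict S))
    (S : Set (Config N)) (hS : IsCompact S) :
    MemLp (fun ξ => conj (a ξ) * a ξ) 2 (volume.restrict S) := by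
  have : ENNReal.HolderTriple 4 4 2 := ⟨by
    rw [show (4 : ENNReal) = 2 * 2 by norm_num, ENNReal.mul_inv (by simp) (by simp), ← mul_add,
      ENNReal.inv_two_add_inv_two, mul_one]⟩
  exact MemLp.mul (ha S hS) (ha S hS).star

/-- The function `x ↦ ⟨κ, x⟩ s(x)`. -/
def position (κ : Config N) (s : 𝓢(Config N, ℂ)) : 𝓢(Config N, ℂ) :=
  smulLeftCLM ℂ (fun x : Config N => ((inner ℝ κ x : ℝ) : ℂ)) s

theorem position_apply (κ : Config N) (s : 𝓢(Config N, ℂ)) (x : Config N) :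
    position κ s x = ((inner ℝ κ x : ℝ) : ℂ) * s x :=
  smulLeftCLM_apply_apply (by fun_prop) s x

theorem position_toLp_ae (κ : Config N) (s : 𝓢(Config N, ℂ)) :
    (position κ s).toLp 2 volume =ᵐ[volume]
      fun x => ((inner ℝ κ x : ℝ) : ℂ) * (s.toLp 2 volume) x := by
  filter_upwards [(position κ s).coeFn_toLp 2 volume, s.coeFn_toLp 2 volume] with x h1 h2
  rw [h1, h2, position_apply]

theorem app_position (κ : Config N) (s : 𝓢(Config N, ℂ)) :
    s.toLp 2 volume ∈ (mulOp fun x => ((inner ℝ κ x : ℝ) : ℂ)).domain ∧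
    app (mulOp fun x => ((inner ℝ κ x : ℝ) : ℂ)) (s.toLp 2 volume) = (position κ s).toLp 2 := by
  have hm : MemLp (fun x => ((inner ℝ κ x : ℝ) : ℂ) * (s.toLp 2 volume) x) 2 volume :=
    (Lp.memLp _).ae_eq (position_toLp_ae κ s)
  refine ⟨mem_mulOp.2 hm, ?_⟩
  rw [app_mulOp hm]
  refine Lp.ext ?_
  filter_upwards [hm.coeFn_toLp, position_toLp_ae κ s] with x h1 h2
  rw [h1, h2]

theorem app_mulOp_phase {g : Config N → ℂ} {ψ : Hilb N} (h : ψ ∈ (mulOp g).domain)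
    (κ : Config N) :
    phase κ ψ ∈ (mulOp g).domain ∧ app (mulOp g) (phase κ ψ) = phase κ (app (mulOp g) ψ) := by
  have hae : phase κ (app (mulOp g) ψ) =ᵐ[volume] fun x => g x * phase κ ψ x := by
    rw [app_mulOp (mem_mulOp.1 h)]
    filter_upwards [phase_coe κ ((mem_mulOp.1 h).toLp _), phase_coe κ ψ,
      (mem_mulOp.1 h).coeFn_toLp] with x h1 h2 h3
    rw [h1, h2, h3]
    ring
  have hm : MemLp (fun x => g x * phase κ ψ x) 2 volume := (Lp.memLp _).ae_eq hae
  refine ⟨mem_mulOp.2 hm, ?_⟩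
  rw [app_mulOp hm]
  refine Lp.ext ?_
  filter_upwards [hm.coeFn_toLp, hae] with x h1 h2
  rw [h1, h2]

/-- Taylor's bound covers `|t| ≤ 1`; beyond it the triangle inequality gives `2 + |t| ≤ 3t²`.
Because it is global, the remainder in `hasDerivAt_phase` is dominated by `⟨κ, x⟩² s(x)`, which is
again Schwartz. -/
theorem norm_exp_sub_one_sub_le (t : ℝ) :
    ‖Complex.exp (-Complex.I * t) - 1 - -Complex.I * t‖ ≤ 3 * t ^ 2 := by
  have hn : ‖-Complex.I * (t : ℂ)‖ = |t| := by simp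
  rcases le_or_gt |t| 1 with h | h
  · refine (Complex.norm_exp_sub_one_sub_id_le (hn.trans_le h)).trans ?_
    rw [hn, sq_abs]
    nlinarith [sq_nonneg t]
  · have h1 : ‖Complex.exp (-Complex.I * t)‖ = 1 := by
      rw [Complex.norm_exp]; simp
    calc ‖Complex.exp (-Complex.I * t) - 1 - -Complex.I * t‖
        ≤ ‖Complex.exp (-Complex.I * t)‖ + ‖(1 : ℂ)‖ + ‖-Complex.I * (t : ℂ)‖ :=
          (norm_sub_le _ _).trans (add_le_add_left (norm_sub_le _ _) _)
      _ = 2 + |t| := by rw [h1, hn, norm_one]; ring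
      _ ≤ 3 * t ^ 2 := by rw [← sq_abs]; nlinarith

theorem hasDerivAt_phase (κ : Config N) (s : 𝓢(Config N, ℂ)) :
    HasDerivAt (fun t : ℝ => phase (t • κ) (s.toLp 2 volume))
      (-Complex.I • (position κ s).toLp 2 volume) 0 := by
  have hb : ∀ t : ℝ, ‖phase ((0 + t) • κ) (s.toLp 2 volume) -
      phase ((0 : ℝ) • κ) (s.toLp 2 volume) -
      t • (-Complex.I • (position κ s).toLp 2 volume)‖ ≤
      3 * ‖(position κ (position κ s)).toLp 2 volume‖ * ‖t ^ 2‖ := by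
    intro t
    rw [zero_add, zero_smul, phase_zero, mul_right_comm]
    refine Lp.norm_le_mul_norm_of_ae_le_mul ?_
    filter_upwards [Lp.coeFn_sub (phase (t • κ) (s.toLp 2 volume) - s.toLp 2 volume)
        (t • (-Complex.I • (position κ s).toLp 2 volume)),
      Lp.coeFn_sub (phase (t • κ) (s.toLp 2 volume)) (s.toLp 2 volume),
      Lp.coeFn_smul t (-Complex.I • (position κ s).toLp 2 volume),
      Lp.coeFn_smul (-Complex.I) ((position κ s).toLp 2 volume),
      phase_coe (t • κ) (s.toLp 2 volume),
      position_toLp_ae κ s, position_toLp_ae κ (position κ s)] with x h1 h2 h3 h4 h5 h6 h7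
    rw [h1, Pi.sub_apply, h2, Pi.sub_apply, h3, Pi.smul_apply, h4, Pi.smul_apply, h5, h7, h6,
      inner_smul_left]
    have e : Complex.exp (-Complex.I * ((conj t * inner ℝ κ x : ℝ) : ℂ)) * (s.toLp 2 volume) x -
        (s.toLp 2 volume) x - t • (-Complex.I • (((inner ℝ κ x : ℝ) : ℂ) * (s.toLp 2 volume) x)) =
        (Complex.exp (-Complex.I * ((t * inner ℝ κ x : ℝ) : ℂ)) - 1 -
          -Complex.I * ((t * inner ℝ κ x : ℝ) : ℂ)) * (s.toLp 2 volume) x := by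
      simp only [conj_trivial, Complex.real_smul, smul_eq_mul]
      push_cast
      ring
    rw [e, norm_mul, norm_mul, norm_mul, Complex.norm_real, Real.norm_eq_abs]
    refine (mul_le_mul_of_nonneg_right (norm_exp_sub_one_sub_le _) (norm_nonneg _)).trans_eq ?_
    rw [Real.norm_eq_abs (inner ℝ κ x), abs_of_nonneg (sq_nonneg t), mul_pow,
      ← sq_abs (inner ℝ κ x)]
    ring
  rw [hasDerivAt_iff_isLittleO_nhds_zero]
  exact (Asymptotics.IsBigO.of_bound _ (Eventually.of_forall hb)).trans_isLittleO
    (Asymptotics.isLittleO_pow_id one_lt_two)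

theorem app_add {S T : Hilb N →ₗ.[ℂ] Hilb N} {x : Hilb N} (hS : x ∈ S.domain)
    (hT : x ∈ T.domain) : app (S + T) x = app S x + app T x := by
  rw [app_of_mem hS, app_of_mem hT, app_of_mem (T := S + T) (by exact ⟨hS, hT⟩)]
  rfl

variable {ħ : ℝ}

theorem app_driftOp (κ : Config N) {g : Config N → ℝ} {β : 𝓢(Config N, ℂ)}
    (hm : MemLp (fun ξ => (g ((2 * Real.pi * ħ) • ξ) : ℂ) * β ξ) 2 volume) :
    app (driftOp ħ κ g) (vec β) = (position κ (𝓕⁻ β)).toLp 2 volume + FT.symm (hm.toLp _) := by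
  have hae : (fun ξ => (g ((2 * Real.pi * ħ) • ξ) : ℂ) * FT (vec β) ξ) =ᵐ[volume]
      fun ξ => (g ((2 * Real.pi * ħ) • ξ) : ℂ) * β ξ := by
    filter_upwards [FT_vec_ae β] with ξ h
    rw [h]
  have hm' := hm.ae_eq hae.symm
  rw [driftOp, app_add (by rw [vec_eq]; exact (app_position κ _).1)
    ((mem_momOp (f := fun p => (g p : ℂ))).2 hm'), app_momOp (f := fun p => (g p : ℂ)) hm']
  congr 1
  · rw [vec_eq]; exact (app_position κ _).2
  · congr 1
    exact (MemLp.toLp_eq_toLp_iff _ _).2 hae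

variable {f : Config N → ℂ} {κ : Config N}

theorem app_adjoint_jumpOp_vec (hf : MulCompact fun ξ => f ((2 * Real.pi * ħ) • ξ))
    {β : 𝓢(Config N, ℂ)}
    (hm : MemLp (fun ξ => conj (f ((2 * Real.pi * ħ) • ξ)) *
      shift ((2 * Real.pi)⁻¹ • κ) β ξ) 2 volume) :
    app (jumpOp ħ κ f)† (vec β) = FT.symm (hm.toLp _) := by
  have hae : (fun ξ => conj (f ((2 * Real.pi * ħ) • ξ)) * FT (phase (-κ) (vec β)) ξ) =ᵐ[volume]
      fun ξ => conj (f ((2 * Real.pi * ħ) • ξ)) * shift ((2 * Real.pi)⁻¹ • κ) β ξ := by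
    rw [phase_vec, neg_smul, smul_neg, neg_neg]
    filter_upwards [FT_vec_ae (shift ((2 * Real.pi)⁻¹ • κ) β)] with ξ h
    rw [h]
  rw [(adjoint_jumpOp hf (vec β) (hm.ae_eq hae.symm)).2]
  congr 1
  exact (MemLp.toLp_eq_toLp_iff _ _).2 hae

theorem app_adjoint_app_jumpOp_vec (hf : MulCompact fun ξ => f ((2 * Real.pi * ħ) • ξ))
    {β : 𝓢(Config N, ℂ)} (hβ : HasCompactSupport β)
    (hm : MemLp (fun ξ => conj (f ((2 * Real.pi * ħ) • ξ)) * f ((2 * Real.pi * ħ) • ξ) * β ξ)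
      2 volume) :
    app (jumpOp ħ κ f)† (app (jumpOp ħ κ f) (vec β)) = FT.symm (hm.toLp _) := by
  have h1 := hf.vec_mem β hβ
  have hae : (fun ξ => conj (f ((2 * Real.pi * ħ) • ξ)) *
      FT (phase (-κ) (app (jumpOp ħ κ f) (vec β))) ξ) =ᵐ[volume]
      fun ξ => conj (f ((2 * Real.pi * ħ) • ξ)) * f ((2 * Real.pi * ħ) • ξ) * β ξ := by
    rw [app_jumpOp h1, phase_phase, neg_add_cancel, phase_zero,
      LinearIsometryEquiv.apply_symm_apply]
    filter_upwards [h1.coeFn_toLp, FT_vec_ae β] with ξ h2 h3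
    rw [h2, h3]
    exact (mul_assoc _ _ _).symm
  rw [(adjoint_jumpOp hf _ (hm.ae_eq hae.symm)).2]
  congr 1
  exact (MemLp.toLp_eq_toLp_iff _ _).2 hae

end

/-! ### Diagonal matrix elements of the relaxation superoperator -/

theorem position_shift (κ c : Config N) (α : 𝓢(Config N, ℂ)) :
    (position κ (𝓕⁻ (shift c α))).toLp 2 volume =
      phase (-(2 * Real.pi) • c) ((position κ (𝓕⁻ α)).toLp 2 volume) := by
  rw [← (app_position κ _).2, ← (app_position κ _).2, ← vec_eq, ← vec_eq, ← phase_two_pi_vec]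
  exact (app_mulOp_phase (by rw [vec_eq]; exact (app_position κ _).1) _).2

theorem position_smul_toLp (t : ℝ) (κ : Config N) (s : 𝓢(Config N, ℂ)) :
    (position (t • κ) s).toLp 2 volume = (t : ℂ) • (position κ s).toLp 2 volume := by
  refine Lp.ext ?_
  filter_upwards [position_toLp_ae (t • κ) s, position_toLp_ae κ s,
    Lp.coeFn_smul (t : ℂ) ((position κ s).toLp 2 volume)] with x h1 h2 h3
  rw [h1, h3, Pi.smul_apply, h2, inner_smul_left]
  simp only [conj_trivial, smul_eq_mul]
  push_cast
  ring

namespace ThermalData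

variable {H : Hilb N →ₗ.[ℂ] Hilb N} {θ : ℝ} (G : ThermalData H θ)

theorem summable_weight_basis : Summable fun n => G.weight n * ‖G.basis n‖ ^ 2 := by
  simpa [G.norm_basis] using G.summable_weight

/-- The expectation `⟨φ_c, ρ φ_c⟩` along the orbit of momentum translations. -/
theorem re_inner_state_phase (ψ : Hilb N) (c : Config N) :
    (inner ℂ (phase (-(2 * Real.pi) • c) ψ) (G.state (phase (-(2 * Real.pi) • c) ψ))).re =
      orbitSum G.weight G.basis ψ c :=
  (G.hasSum_re_inner_state _).tsum_eq.symm

/-- Termwise `2ab ≤ a² + b²`. Off-diagonal elements along an orbit are thereby dominated by orbit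
sums, which are integrable. -/
theorem norm_inner_state_le (φ ψ : Hilb N) : ‖inner ℂ φ (G.state ψ)‖ ≤
    ((inner ℂ φ (G.state φ)).re + (inner ℂ ψ (G.state ψ)).re) / 2 := by
  have hs := ((G.hasSum_re_inner_state φ).add (G.hasSum_re_inner_state ψ)).div_const 2
  rw [← (G.hasSum_inner_state φ ψ).tsum_eq]
  refine tsum_of_norm_bounded hs fun n => ?_
  rw [norm_mul, norm_mul, Complex.norm_real, Real.norm_of_nonneg (G.weight_pos n).le,
    norm_inner_symm φ]
  have := mul_nonneg (G.weight_pos n).le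
    (sq_nonneg (‖inner ℂ (G.basis n) φ‖ - ‖inner ℂ (G.basis n) ψ‖))
  nlinarith

/-- The derivative of `⟨φ_c, ρ φ_c⟩` in the direction `κ`. -/
def flow (κ : Config N) (α : 𝓢(Config N, ℂ)) (c : Config N) : ℝ :=
  4 * Real.pi * (inner ℂ ((position κ (𝓕⁻ (shift c α))).toLp 2 volume)
    (G.state (vec (shift c α)))).im

/-- The factor `4π` in `flow` is `2π` from the modulation times `2` from the two slots of the inner
product, which contribute equally because the state is Hermitian. -/
theorem hasLineDerivAt_flow (κ : Config N) (α : 𝓢(Config N, ℂ)) (c : Config N) :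
    HasLineDerivAt ℝ (orbitSum G.weight G.basis (vec α)) (G.flow κ α c) c κ := by
  set x := (position κ (𝓕⁻ (shift c α))).toLp 2 volume with hx
  set y := vec (shift c α) with hy
  have hd := hasDerivAt_phase (-(2 * Real.pi) • κ) (𝓕⁻ (shift c α))
  rw [← vec_eq, ← hy, position_smul_toLp, ← hx] at hd
  have hd2 : HasDerivAt (fun t : ℝ => G.state (phase (t • -(2 * Real.pi) • κ) y))
      (G.state (-Complex.I • ((-(2 * Real.pi) : ℝ) : ℂ) • x)) 0 :=
    (G.state.restrictScalars ℝ).hasFDerivAt.comp_hasDerivAt 0 hd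
  have h := Complex.reCLM.hasFDerivAt.comp_hasDerivAt (0 : ℝ) (hd.inner ℂ hd2)
  simp only [zero_smul, phase_zero] at h
  refine (h.congr_of_eventuallyEq (Eventually.of_forall fun t => ?_)).congr_deriv ?_
  · simp only [Function.comp_apply, Complex.reCLM_apply]
    rw [← G.re_inner_state_phase, hy, ← phase_two_pi_vec c, phase_phase]
    have e : -(2 * Real.pi) • (c + t • κ) = t • -(2 * Real.pi) • κ + -(2 * Real.pi) • c := by
      module
    rw [e]
  · rw [Complex.reCLM_apply, flow, ← hx, ← hy]
    simp only [map_smul, inner_smul_left, inner_smul_right, map_neg, Complex.conj_I,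
      Complex.conj_ofReal]
    rw [G.inner_state_comm y x]
    generalize inner ℂ x (G.state y) = z
    simp
    ring

theorem integrable_flow (κ : Config N) (α : 𝓢(Config N, ℂ)) : Integrable (G.flow κ α) volume := by
  set x := (position κ (𝓕⁻ α)).toLp 2 volume with hx
  have hfl : ∀ c, G.flow κ α c = 4 * Real.pi * (inner ℂ (phase (-(2 * Real.pi) • c) x)
      (G.state (phase (-(2 * Real.pi) • c) (vec α)))).im := fun c => by
    rw [flow, position_shift, phase_two_pi_vec]
  have hm : Measurable fun c : Config N => inner ℂ (phase (-(2 * Real.pi) • c) x)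
      (G.state (phase (-(2 * Real.pi) • c) (vec α))) := by
    simp_rw [← (G.hasSum_inner_state _ _).tsum_eq, ← inner_conj_symm (phase _ x)]
    exact Measurable.tsum fun n => measurable_const.mul
      ((Complex.continuous_conj.comp (continuous_inner_phase (G.basis n) x)).measurable.mul
        (continuous_inner_phase (G.basis n) (vec α)).measurable)
  have hi1 := integrable_orbitSum (fun n => (G.weight_pos n).le) G.summable_weight_basis
    (position κ (𝓕⁻ α))
  have hi2 := integrable_orbitSum (fun n => (G.weight_pos n).le) G.summable_weight_basis (𝓕⁻ α)
  rw [← vec_eq] at hi2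
  rw [funext hfl]
  refine Integrable.const_mul (((hi1.add hi2).div_const 2).mono'
    (Complex.measurable_im.comp hm).aestronglyMeasurable (Eventually.of_forall fun c => ?_)) _
  refine (Complex.abs_im_le_norm _).trans ((G.norm_inner_state_le _ _).trans_eq ?_)
  rw [G.re_inner_state_phase, G.re_inner_state_phase]
  rfl

/-- Integration by parts against the constant `1`: both the orbit sum and its directional derivative
are integrable. -/
theorem integral_flow (κ : Config N) (α : 𝓢(Config N, ℂ)) : ∫ c, G.flow κ α c = 0 := by
  have hi := integrable_orbitSum (fun n => (G.weight_pos n).le) G.summable_weight_basis (𝓕⁻ α)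
  rw [← vec_eq] at hi
  have := integral_bilinear_hasLineDerivAt_right_eq_neg_left_of_integrable
    (μ := (volume : Measure (Config N))) (f := fun _ => (1 : ℝ)) (f' := fun _ => 0)
    (g := orbitSum G.weight G.basis (vec α)) (g' := G.flow κ α) (v := κ)
    (B := ContinuousLinearMap.mul ℝ ℝ) (by simp) (by simpa using G.integrable_flow κ α)
    (by simpa using hi) (fun c _ => hasDerivAt_const _ _)
    (fun c _ => G.hasLineDerivAt_flow κ α c)
  simpa using this

/-- The dissipation `½ ∬ |a(ξ) - a(η)|² β(ξ) β(η) r(ξ, η) dξ dη`. -/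
def dissipation (a : Config N → ℂ) (β : 𝓢(Config N, ℂ)) : ℝ :=
  1 / 2 * ∫ p : Config N × Config N, ‖a p.1 - a p.2‖ ^ 2 *
    ((β p.1).re * (β p.2).re * (G.kernel p.1 p.2).re) ∂(volume.prod volume)

theorem inner_vec_state {u : Config N → ℂ} (hu : MemLp u 2 volume) (β : 𝓢(Config N, ℂ)) :
    Integrable (fun p : Config N × Config N => conj (u p.1) * β p.2 * G.kernel p.1 p.2)
      (volume.prod volume) ∧
    inner ℂ (FT.symm (hu.toLp u)) (G.state (vec β))
      = ∫ p, conj (u p.1) * β p.2 * G.kernel p.1 p.2 ∂(volume.prod volume) :=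
  G.inner_state_eq_integral hu (β.memLp 2 volume)

/-- With `β` and the kernel real, everything reduces to `|a₁|² + |a₂|² - 2 Re (a₁ conj a₂) = |a₁ -
a₂|²`. Here `F1` and `F2` come from the two halves of the anticommutator and `F3` from the term
`AρA†`. -/
theorem integrable_dissipation_and_eq
    (hK : ∀ᵐ p ∂((volume : Measure (Config N)).prod (volume : Measure (Config N))),
      0 < G.kernel p.1 p.2)
    {a : Config N → ℂ} {β : 𝓢(Config N, ℂ)} (hβ : ∀ ξ, conj (β ξ) = β ξ)
    (h1 : MemLp (fun ξ => conj (a ξ) * β ξ) 2 volume)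
    (h2 : MemLp (fun ξ => conj (a ξ) * a ξ * β ξ) 2 volume) :
    Integrable (fun p : Config N × Config N => ‖a p.1 - a p.2‖ ^ 2 *
      ((β p.1).re * (β p.2).re * (G.kernel p.1 p.2).re)) (volume.prod volume) ∧
    (inner ℂ (FT.symm (h2.toLp _)) (G.state (vec β))).re =
      (inner ℂ (FT.symm (h1.toLp _)) (G.state (FT.symm (h1.toLp _)))).re +
        G.dissipation a β := by
  obtain ⟨i1, e1⟩ := G.inner_vec_state h2 β
  obtain ⟨i2, e2⟩ := G.inner_state_eq_integral (β.memLp 2 volume) h2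
  obtain ⟨i3, e3⟩ := G.inner_state_eq_integral h1 h1
  set F1 : Config N × Config N → ℂ := fun p =>
    conj (conj (a p.1) * a p.1 * β p.1) * β p.2 * G.kernel p.1 p.2 with hF1
  set F2 : Config N × Config N → ℂ := fun p =>
    conj (β p.1) * (conj (a p.2) * a p.2 * β p.2) * G.kernel p.1 p.2 with hF2
  set F3 : Config N × Config N → ℂ := fun p =>
    conj (conj (a p.1) * β p.1) * (conj (a p.2) * β p.2) * G.kernel p.1 p.2 with hF3
  have i12 : Integrable (fun p => F1 p + F2 p) (volume.prod volume) := i1.add i2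
  have i33 : Integrable (fun p => 2 * F3 p) (volume.prod volume) := i3.const_mul 2
  have i4 : Integrable (fun p => F1 p + F2 p - 2 * F3 p) (volume.prod volume) := i12.sub i33
  have e4 : ∀ᵐ p ∂((volume : Measure (Config N)).prod (volume : Measure (Config N))),
      (F1 p + F2 p - 2 * F3 p).re =
      ‖a p.1 - a p.2‖ ^ 2 * ((β p.1).re * (β p.2).re * (G.kernel p.1 p.2).re) := by
    filter_upwards [hK] with p hp
    have hk : (G.kernel p.1 p.2).im = 0 := (Complex.lt_def.1 hp).2.symm
    have hb1 : (β p.1).im = 0 := Complex.conj_eq_iff_im.1 (hβ _)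
    have hb2 : (β p.2).im = 0 := Complex.conj_eq_iff_im.1 (hβ _)
    rw [← Complex.normSq_eq_norm_sq, Complex.normSq_apply, hF1, hF2, hF3]
    simp [Complex.mul_re, Complex.mul_im, hk, hb1, hb2]
    ring
  refine ⟨i4.re.congr e4, ?_⟩
  have hre : ∫ p, (F1 p + F2 p - 2 * F3 p).re ∂(volume.prod volume) =
      (∫ p, (F1 p + F2 p - 2 * F3 p) ∂(volume.prod volume)).re := integral_re i4
  rw [integral_congr_ae e4, integral_sub i12 i33, integral_add i1 i2, integral_const_mul, ← e1,
    ← e2, ← e3] at hre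
  have hsym := congrArg Complex.re (G.inner_state_comm (vec β) (FT.symm (h2.toLp _)))
  rw [Complex.conj_re] at hsym
  change _ = Complex.re (_ + inner ℂ (vec β) _ - _) at hre
  simp only [Complex.add_re, Complex.sub_re, hsym, Complex.mul_re, Complex.re_ofNat,
    Complex.im_ofNat, zero_mul, sub_zero] at hre
  rw [dissipation, hre]
  ring

theorem dissipation_nonneg
    (hK : ∀ᵐ p ∂((volume : Measure (Config N)).prod (volume : Measure (Config N))),
      0 < G.kernel p.1 p.2) (a : Config N → ℂ) {β : 𝓢(Config N, ℂ)} (hβ : ∀ ξ, 0 ≤ (β ξ).re) :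
    0 ≤ G.dissipation a β := by
  refine mul_nonneg (by norm_num) (integral_nonneg_of_ae ?_)
  filter_upwards [hK] with p hp
  exact mul_nonneg (sq_nonneg _) (mul_nonneg (mul_nonneg (hβ _) (hβ _)) (Complex.lt_def.1 hp).1.le)

end ThermalData

/-! ### Vanishing of the dissipation -/

theorem hasCompactSupport_shift (c : Config N) {β : 𝓢(Config N, ℂ)} (hβ : HasCompactSupport β) :
    HasCompactSupport (shift c β) := by
  have e : (⇑(shift c β)) = β ∘ Homeomorph.addRight (-c) := by
    funext x
    simp [compSubConstCLM_apply, sub_eq_add_neg]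
  rw [e]
  exact hβ.comp_homeomorph _

theorem exists_bump {r : ℝ} (hr : 0 < r) : ∃ α : 𝓢(Config N, ℂ), HasCompactSupport α ∧
    (∀ ξ, conj (α ξ) = α ξ) ∧ (∀ ξ, 0 ≤ (α ξ).re) ∧ ∀ ξ ∈ Metric.ball (0 : Config N) r,
      0 < (α ξ).re := by
  let b : ContDiffBump (0 : Config N) := ⟨r / 2, r, by linarith, by linarith⟩
  have hg1 : HasCompactSupport fun x => (b x : ℂ) :=
    b.hasCompactSupport.comp_left Complex.ofReal_zero
  have hg2 : ContDiff ℝ ∞ fun x => (b x : ℂ) := Complex.ofRealCLM.contDiff.comp b.contDiff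
  exact ⟨hg1.toSchwartzMap hg2, hg1, fun ξ => Complex.conj_ofReal (b ξ), fun ξ => b.nonneg,
    fun ξ hξ => b.pos_of_mem_ball hξ⟩

/-- Balls of integer radius exhaust the space; by Fubini some `ξ` satisfies `a ξ = a η` for almost
every `η`, and `a ξ` is the constant. -/
theorem ae_const_of_ball {X : Type*} {a : Config N → X}
    (h : ∀ r : ℝ, 0 < r → ∀ᵐ p ∂((volume : Measure (Config N)).prod
      (volume : Measure (Config N))),
      p.1 ∈ Metric.ball (0 : Config N) r → p.2 ∈ Metric.ball (0 : Config N) r → a p.1 = a p.2) :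
    ∃ c, ∀ᵐ ξ, a ξ = c := by
  have h1 : ∀ᵐ p ∂((volume : Measure (Config N)).prod (volume : Measure (Config N))),
      a p.1 = a p.2 := by
    filter_upwards [ae_all_iff.2 fun n : ℕ => h (n + 1) n.cast_add_one_pos] with p hp
    obtain ⟨n, hn⟩ := exists_nat_gt (max ‖p.1‖ ‖p.2‖)
    refine hp n ?_ ?_ <;> rw [mem_ball_zero_iff]
    · linarith [le_max_left ‖p.1‖ ‖p.2‖]
    · linarith [le_max_right ‖p.1‖ ‖p.2‖]
  obtain ⟨ξ, hξ⟩ := (Measure.ae_ae_of_ae_prod h1).exists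
  exact ⟨a ξ, hξ.mono fun η hη => hη.symm⟩

theorem re_neg_I_mul_sub_conj (z : ℂ) : (-Complex.I * (z - conj z)).re = 2 * z.im := by
  simp
  ring

namespace ThermalData

variable {H : Hilb N →ₗ.[ℂ] Hilb N} {θ : ℝ} (G : ThermalData H θ)

/-- The wave function `f(p̂) ψₙ`, given that it exists, where `a(ξ) = f(2πħξ)`. -/
def mulBasis {a : Config N → ℂ} (hb : ∀ n, MemLp (fun ξ => a ξ * FT (G.basis n) ξ) 2 volume)
    (n : ℕ) : Hilb N :=
  FT.symm ((hb n).toLp _)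

theorem re_inner_state_mul {a : Config N → ℂ}
    (hb : ∀ n, MemLp (fun ξ => a ξ * FT (G.basis n) ξ) 2 volume) {β : 𝓢(Config N, ℂ)}
    (hm : MemLp (fun ξ => conj (a ξ) * β ξ) 2 volume) :
    (inner ℂ (FT.symm (hm.toLp _)) (G.state (FT.symm (hm.toLp _)))).re =
      ∑' n, G.weight n * ‖inner ℂ (G.mulBasis hb n) (vec β)‖ ^ 2 := by
  rw [← (G.hasSum_re_inner_state _).tsum_eq]
  refine tsum_congr fun n => ?_
  congr 3
  rw [mulBasis, inner_FT_symm_toLp, ← inner_FT, LinearIsometryEquiv.apply_symm_apply, inner_hilb]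
  refine integral_congr_ae ?_
  filter_upwards [hm.coeFn_toLp, FT_vec_ae β] with ξ h1 h2
  rw [h1, h2, map_mul]
  ring

/-- The gain is the quadratic form of `f(p̂) ρ f(p̂)†` at the kicked test function. The loss is the
same form at the original one, plus the dissipation. -/
theorem re_dissForm
    (hK : ∀ᵐ p ∂((volume : Measure (Config N)).prod (volume : Measure (Config N))),
      0 < G.kernel p.1 p.2) {ħ : ℝ} {f : Config N → ℂ} (κ : Config N)
    (ha : ∀ S : Set (Config N), IsCompact S →
      MemLp (fun ξ => f ((2 * Real.pi * ħ) • ξ)) 4 (volume.restrict S))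
    (hb : ∀ n, MemLp (fun ξ => f ((2 * Real.pi * ħ) • ξ) * FT (G.basis n) ξ) 2 volume)
    {β : 𝓢(Config N, ℂ)} (hc : HasCompactSupport β) (hβ : ∀ ξ, conj (β ξ) = β ξ) :
    Integrable (fun p : Config N × Config N =>
      ‖f ((2 * Real.pi * ħ) • p.1) - f ((2 * Real.pi * ħ) • p.2)‖ ^ 2 *
      ((β p.1).re * (β p.2).re * (G.kernel p.1 p.2).re)) (volume.prod volume) ∧
    (dissForm (jumpOp ħ κ f) G.state (vec β) (vec β)).re =
      ∑' n, G.weight n * ‖inner ℂ (G.mulBasis hb n) (vec (shift ((2 * Real.pi)⁻¹ • κ) β))‖ ^ 2 -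
      ∑' n, G.weight n * ‖inner ℂ (G.mulBasis hb n) (vec β)‖ ^ 2 -
      G.dissipation (fun ξ => f ((2 * Real.pi * ħ) • ξ)) β := by
  have hf : MulCompact fun ξ => f ((2 * Real.pi * ħ) • ξ) := fun u hu hu' =>
    memLp_mul_of_loc (memLp_two_of_four ha) hu hu'
  have hcs := hasCompactSupport_shift ((2 * Real.pi)⁻¹ • κ) hc
  have m1 : MemLp (fun ξ => conj (f ((2 * Real.pi * ħ) • ξ)) * β ξ) 2 volume :=
    memLp_mul_of_loc (fun S hS => (memLp_two_of_four ha S hS).star) β.continuous hc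
  have m1s : MemLp (fun ξ => conj (f ((2 * Real.pi * ħ) • ξ)) *
      shift ((2 * Real.pi)⁻¹ • κ) β ξ) 2 volume :=
    memLp_mul_of_loc (fun S hS => (memLp_two_of_four ha S hS).star) (SchwartzMap.continuous _) hcs
  have m2 : MemLp (fun ξ => conj (f ((2 * Real.pi * ħ) • ξ)) * f ((2 * Real.pi * ħ) • ξ) * β ξ)
      2 volume := memLp_mul_of_loc (memLp_conj_mul_self ha) β.continuous hc
  obtain ⟨hi, he⟩ := G.integrable_dissipation_and_eq hK (a := fun ξ => f ((2 * Real.pi * ħ) • ξ))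
    hβ m1 m2
  refine ⟨hi, ?_⟩
  rw [dissForm, app_adjoint_jumpOp_vec hf m1s, app_adjoint_app_jumpOp_vec hf hc m2,
    G.inner_state_comm (vec β) (FT.symm _), Complex.add_conj, Complex.sub_re,
    G.re_inner_state_mul hb m1s]
  have : ((1 / 2 : ℂ) * ((2 * (inner ℂ (FT.symm (m2.toLp _)) (G.state (vec β))).re : ℝ) : ℂ)).re
      = (inner ℂ (FT.symm (m2.toLp _)) (G.state (vec β))).re := by
    push_cast
    rw [← mul_assoc, one_div, inv_mul_cancel₀ two_ne_zero, one_mul, Complex.ofReal_re]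
  rw [this, he, G.re_inner_state_mul hb m1]
  ring

/-- For real `β` and real kernel, `⟨f_aux(p̂)φ, ρφ⟩` is real and drops out of the commutator; only
the force remains on the diagonal. -/
theorem re_commForm_driftOp
    (hK : ∀ᵐ p ∂((volume : Measure (Config N)).prod (volume : Measure (Config N))),
      0 < G.kernel p.1 p.2) {ħ : ℝ} {g : Config N → ℝ} (κ : Config N)
    {β : 𝓢(Config N, ℂ)} (hβ : ∀ ξ, conj (β ξ) = β ξ)
    (hm : MemLp (fun ξ => (g ((2 * Real.pi * ħ) • ξ) : ℂ) * β ξ) 2 volume) :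
    (-Complex.I * commForm (driftOp ħ κ g) G.state (vec β) (vec β)).re =
      2 * (inner ℂ ((position κ (𝓕⁻ β)).toLp 2 volume) (G.state (vec β))).im := by
  obtain ⟨hi, he⟩ := G.inner_vec_state hm β
  have h0 : (inner ℂ (FT.symm (hm.toLp _)) (G.state (vec β))).im = 0 := by
    rw [he, ← Complex.imCLM_apply, ← ContinuousLinearMap.integral_comp_comm _ hi]
    refine integral_eq_zero_of_ae ?_
    filter_upwards [hK] with p hp
    have hk : (G.kernel p.1 p.2).im = 0 := (Complex.lt_def.1 hp).2.symm
    have hb1 : (β p.1).im = 0 := Complex.conj_eq_iff_im.1 (hβ _)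
    have hb2 : (β p.2).im = 0 := Complex.conj_eq_iff_im.1 (hβ _)
    simp [Complex.mul_im, hk, hb1, hb2]
  rw [commForm, app_driftOp κ hm, G.inner_state_comm (vec β) (_ + _), re_neg_I_mul_sub_conj,
    inner_add_left, Complex.add_im, h0, add_zero]

end ThermalData

namespace Relaxation

variable {H : Hilb N →ₗ.[ℂ] Hilb N} {θ : ℝ} {G : ThermalData H θ} {R : Relaxation N K} {ħ : ℝ}

theorem IsRegular.f_scaled (hreg : R.IsRegular) (hħ : 0 < ħ) (k : Fin K) (S : Set (Config N))
    (hS : IsCompact S) : MemLp (fun ξ => R.f k ((2 * Real.pi * ħ) • ξ)) 4 (volume.restrict S) :=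
  loc_comp_smul (hreg.f_mem k) (by positivity) S hS

theorem IsRegular.faux_scaled (hreg : R.IsRegular) (hħ : 0 < ħ) (S : Set (Config N))
    (hS : IsCompact S) :
    MemLp (fun ξ => (R.faux ((2 * Real.pi * ħ) • ξ) : ℂ)) 2 (volume.restrict S) :=
  loc_comp_smul (a := fun ξ => (R.faux ξ : ℂ)) (fun S hS => (hreg.faux_mem S hS).ofReal)
    (by positivity) S hS

theorem FiniteRates.memLp (hrate : R.FiniteRates ħ G) (k : Fin K) (n : ℕ) :
    MemLp (fun ξ => R.f k ((2 * Real.pi * ħ) • ξ) * FT (G.basis n) ξ) 2 volume :=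
  mem_jumpOp.1 ((hrate k).1 n)

theorem FiniteRates.summable (hrate : R.FiniteRates ħ G) (k : Fin K) :
    Summable fun n => G.weight n * ‖G.mulBasis (hrate.memLp k) n‖ ^ 2 := by
  refine (hrate k).2.congr fun n => ?_
  rw [A, app_jumpOp (hrate.memLp k n), norm_phase]
  rfl

/-- Stationarity of the thermal state, on the diagonal of the momentum-translation orbit. -/
theorem diag_balance (hħ : 0 < ħ) (hreg : R.IsRegular) (hrate : R.FiniteRates ħ G)
    (hK : ∀ᵐ p ∂((volume : Measure (Config N)).prod (volume : Measure (Config N))),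
      0 < G.kernel p.1 p.2)
    (hform : ∀ α β : 𝓢(Config N, ℂ), HasCompactSupport α → HasCompactSupport β →
      R.form ħ G.state (vec α) (vec β) = 0)
    {α : 𝓢(Config N, ℂ)} (hc : HasCompactSupport α) (hα : ∀ ξ, conj (α ξ) = α ξ)
    (c : Config N) :
    ∑ k, (orbitSum G.weight (G.mulBasis (hrate.memLp k)) (vec α) (c + (2 * Real.pi)⁻¹ • R.κ k) -
        orbitSum G.weight (G.mulBasis (hrate.memLp k)) (vec α) c -
        G.dissipation (fun ξ => R.f k ((2 * Real.pi * ħ) • ξ)) (shift c α)) +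
      (2 * Real.pi)⁻¹ * G.flow R.κaux α c = 0 := by
  have hcs := hasCompactSupport_shift c hc
  have hαs : ∀ ξ, conj (shift c α ξ) = shift c α ξ := fun ξ => hα _
  have h := congrArg Complex.re (hform (shift c α) (shift c α) hcs hcs)
  have hm : MemLp (fun ξ => (R.faux ((2 * Real.pi * ħ) • ξ) : ℂ) * shift c α ξ) 2 volume :=
    memLp_mul_of_loc (hreg.faux_scaled hħ) (SchwartzMap.continuous _) hcs
  rw [form, sub_eq_add_neg, ← neg_mul, Complex.add_re, drift,
    G.re_commForm_driftOp hK R.κaux hαs hm, Complex.re_sum, Complex.zero_re] at h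
  rw [← h, ThermalData.flow]
  congr 1
  · refine Finset.sum_congr rfl fun k _ => ?_
    rw [A, (G.re_dissForm hK (R.κ k) (hreg.f_scaled hħ k) (hrate.memLp k) hcs hαs).2, shift_shift,
      add_comm _ c]
    simp only [orbitSum, phase_two_pi_vec]
  · field_simp
    ring

theorem ae_dissipation_eq_zero (hħ : 0 < ħ) (hreg : R.IsRegular) (hrate : R.FiniteRates ħ G)
    (hK : ∀ᵐ p ∂((volume : Measure (Config N)).prod (volume : Measure (Config N))),
      0 < G.kernel p.1 p.2)
    (hform : ∀ α β : 𝓢(Config N, ℂ), HasCompactSupport α → HasCompactSupport β →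
      R.form ħ G.state (vec α) (vec β) = 0)
    {α : 𝓢(Config N, ℂ)} (hc : HasCompactSupport α) (hα : ∀ ξ, conj (α ξ) = α ξ)
    (hα0 : ∀ ξ, 0 ≤ (α ξ).re) :
    ∀ᵐ c : Config N, ∀ k,
      G.dissipation (fun ξ => R.f k ((2 * Real.pi * ħ) • ξ)) (shift c α) = 0 := by
  set D : Fin K → Config N → ℝ := fun k =>
    orbitSum G.weight (G.mulBasis (hrate.memLp k)) (vec α) with hD
  have hDi : ∀ k, Integrable (D k) volume := fun k => by
    rw [hD, vec_eq]
    exact integrable_orbitSum (fun n => (G.weight_pos n).le) (hrate.summable k) _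
  have hDs : ∀ k, Integrable (fun c => D k (c + (2 * Real.pi)⁻¹ • R.κ k) - D k c) volume :=
    fun k => ((hDi k).comp_add_right _).sub (hDi k)
  have hE : ∀ c, ∑ k, G.dissipation (fun ξ => R.f k ((2 * Real.pi * ħ) • ξ)) (shift c α) =
      ∑ k, (D k (c + (2 * Real.pi)⁻¹ • R.κ k) - D k c) +
        (2 * Real.pi)⁻¹ * G.flow R.κaux α c := fun c => by
    have := diag_balance hħ hreg hrate hK hform hc hα c
    rw [Finset.sum_sub_distrib] at this
    linarith
  have hn : ∀ c k, 0 ≤ G.dissipation (fun ξ => R.f k ((2 * Real.pi * ħ) • ξ)) (shift c α) :=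
    fun c k => G.dissipation_nonneg hK _ fun ξ => hα0 _
  have hi1 : Integrable (fun c => ∑ k, (D k (c + (2 * Real.pi)⁻¹ • R.κ k) - D k c)) volume :=
    integrable_finsetSum _ fun k _ => hDs k
  have hi2 := (G.integrable_flow R.κaux α).const_mul (2 * Real.pi)⁻¹
  have hint : Integrable (fun c => ∑ k, G.dissipation
      (fun ξ => R.f k ((2 * Real.pi * ħ) • ξ)) (shift c α)) volume :=
    (hi1.add hi2).congr (Eventually.of_forall fun c => (hE c).symm)
  -- Translation invariance of Lebesgue measure cancels gain against loss for each `k`, and the flow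
  -- has zero integral. The finite rates make each of these functions integrable.
  have hzero : ∫ c, ∑ k, G.dissipation
      (fun ξ => R.f k ((2 * Real.pi * ħ) • ξ)) (shift c α) = 0 := by
    simp_rw [hE]
    rw [integral_add hi1 hi2, integral_const_mul, G.integral_flow, mul_zero, add_zero,
      integral_finsetSum _ fun k _ => hDs k]
    refine Finset.sum_eq_zero fun k _ => ?_
    rw [integral_sub ((hDi k).comp_add_right _) (hDi k), integral_add_right_eq_self, sub_self]
  filter_upwards [(integral_eq_zero_iff_of_nonneg
    (fun c => Finset.sum_nonneg fun k _ => hn c k) hint).1 hzero] with c h k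
  exact (Finset.sum_eq_zero_iff_of_nonneg fun k _ => hn c k).1 h k (Finset.mem_univ k)

/-- The amplitudes of the jump operators are constant. -/
theorem ae_const_f (hħ : 0 < ħ) (hreg : R.IsRegular) (hrate : R.FiniteRates ħ G)
    (hK : ∀ᵐ p ∂((volume : Measure (Config N)).prod (volume : Measure (Config N))),
      0 < G.kernel p.1 p.2)
    (hform : ∀ α β : 𝓢(Config N, ℂ), HasCompactSupport α → HasCompactSupport β →
      R.form ħ G.state (vec α) (vec β) = 0) (k : Fin K) :
    ∃ c, ∀ᵐ ξ, R.f k ((2 * Real.pi * ħ) • ξ) = c := by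
  refine ae_const_of_ball fun r hr => ?_
  -- The dissipation is known to vanish only for almost every translate. Radius `r + 1` keeps the
  -- bump positive on the ball of radius `r` after any translation by less than `1`.
  obtain ⟨α, hc, hα, hα0, hαp⟩ := exists_bump (N := N) (by linarith : 0 < r + 1)
  obtain ⟨c, hcm, hc1⟩ := (Measure.dense_of_ae
    (ae_dissipation_eq_zero hħ hreg hrate hK hform hc hα hα0)).exists_mem_open
    Metric.isOpen_ball ⟨0, Metric.mem_ball_self one_pos⟩
  have hcs := hasCompactSupport_shift c hc
  have hi := (G.re_dissForm hK (R.κ k) (hreg.f_scaled hħ k) (hrate.memLp k) hcs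
    (fun ξ => hα _)).1
  have h0 := hcm k
  rw [ThermalData.dissipation, mul_eq_zero_iff_left (by norm_num),
    integral_eq_zero_iff_of_nonneg_ae ?_ hi] at h0
  · have hpos : ∀ ξ ∈ Metric.ball (0 : Config N) r, 0 < (shift c α ξ).re := fun ξ hξ => by
      refine hαp _ ?_
      rw [mem_ball_zero_iff] at hξ hc1 ⊢
      exact (norm_sub_le _ _).trans_lt (add_lt_add hξ hc1)
    filter_upwards [h0, hK] with p h1 h2 h3 h4
    have h5 := mul_pos (mul_pos (hpos _ h3) (hpos _ h4)) (Complex.lt_def.1 h2).1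
    have h6 := (mul_eq_zero.1 h1).resolve_right h5.ne'
    rwa [sq_eq_zero_iff, norm_eq_zero, sub_eq_zero] at h6
  · filter_upwards [hK] with p hp
    exact mul_nonneg (sq_nonneg _) (mul_nonneg (mul_nonneg (hα0 _) (hα0 _))
      (Complex.lt_def.1 hp).1.le)

end Relaxation

/-! ### Vanishing of the momentum kicks and of the drift force -/

/-- A function that vanishes at infinity is not constant and nonzero along a line. -/
theorem eq_zero_of_const_on_line {S : Config N → ℝ} (hS : Tendsto S (cocompact (Config N)) (𝓝 0))
    {c v : Config N} {M : ℝ} (hM : 0 < M) (h : ∀ j : ℕ, S (c + (j : ℝ) • v) = M) : v = 0 := by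
  by_contra hv
  have hn : Tendsto (fun j : ℕ => (j : ℝ) * ‖v‖ - ‖c‖) atTop atTop :=
    tendsto_atTop_add_const_right _ _
      (tendsto_natCast_atTop_atTop.atTop_mul_const (norm_pos_iff.2 hv))
  have hc : Tendsto (fun j : ℕ => c + (j : ℝ) • v) atTop (cocompact (Config N)) := by
    rw [← Metric.cobounded_eq_cocompact, ← tendsto_norm_atTop_iff_cobounded]
    refine tendsto_atTop_mono (fun j => ?_) hn
    have := norm_sub_le_norm_add ((j : ℝ) • v) c
    rwa [norm_smul, Real.norm_natCast, add_comm _ c] at this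
  exact hM.ne (tendsto_nhds_unique (hS.comp hc) (tendsto_const_nhds.congr fun j => (h j).symm))

theorem orbitSum_const_smul (w : ℕ → ℝ) (h : ℕ → Hilb N) (a : ℂ) (ψ : Hilb N) (c : Config N) :
    orbitSum w (fun n => a • h n) ψ c = ‖a‖ ^ 2 * orbitSum w h ψ c := by
  rw [orbitSum, orbitSum, ← tsum_mul_left]
  refine tsum_congr fun n => ?_
  rw [inner_smul_left, norm_mul, RCLike.norm_conj]
  ring

theorem toLp_const_mul {a : Config N → ℂ} {z : ℂ} (ha : ∀ᵐ ξ, a ξ = z) {x : Hilb N}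
    (h : MemLp (fun ξ => a ξ * x ξ) 2 volume) : h.toLp _ = z • x := by
  refine Lp.ext ?_
  filter_upwards [h.coeFn_toLp, Lp.coeFn_smul z x, ha] with ξ h1 h2 h3
  rw [h1, h2, h3, Pi.smul_apply, smul_eq_mul]

theorem memLp_const_mul {a : Config N → ℂ} {z : ℂ} (ha : ∀ᵐ ξ, a ξ = z) (x : Hilb N) :
    MemLp (fun ξ => a ξ * x ξ) 2 volume := by
  refine ((Lp.memLp x).const_mul z).ae_eq ?_
  filter_upwards [ha] with ξ h
  rw [h]

namespace ThermalData

variable {H : Hilb N →ₗ.[ℂ] Hilb N} {θ : ℝ} (G : ThermalData H θ)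

theorem mulBasis_of_ae_const {a : Config N → ℂ}
    (hb : ∀ n, MemLp (fun ξ => a ξ * FT (G.basis n) ξ) 2 volume) {z : ℂ} (ha : ∀ᵐ ξ, a ξ = z) :
    G.mulBasis hb = fun n => z • G.basis n := by
  funext n
  rw [mulBasis, toLp_const_mul ha, map_smul, LinearIsometryEquiv.symm_apply_apply]

theorem dissipation_of_ae_const {a : Config N → ℂ} {z : ℂ} (ha : ∀ᵐ ξ, a ξ = z)
    (β : 𝓢(Config N, ℂ)) : G.dissipation a β = 0 := by
  rw [dissipation, integral_eq_zero_of_ae, mul_zero]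
  filter_upwards [Measure.quasiMeasurePreserving_fst.ae ha,
    Measure.quasiMeasurePreserving_snd.ae ha] with p h1 h2
  simp [h1, h2]

theorem orbitSum_zero_pos
    (hK : ∀ᵐ p ∂((volume : Measure (Config N)).prod (volume : Measure (Config N))),
      0 < G.kernel p.1 p.2) {α : 𝓢(Config N, ℂ)} (hα : ∀ ξ, conj (α ξ) = α ξ)
    (hα0 : ∀ ξ, 0 ≤ (α ξ).re) {r : ℝ} (hr : 0 < r)
    (hαp : ∀ ξ ∈ Metric.ball (0 : Config N) r, 0 < (α ξ).re) :
    0 < orbitSum G.weight G.basis (vec α) 0 := by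
  obtain ⟨hi, he⟩ := G.inner_vec_state (α.memLp 2 volume) α
  have he' : orbitSum G.weight G.basis (vec α) 0 = ∫ p : Config N × Config N,
      (conj (α p.1) * α p.2 * G.kernel p.1 p.2).re ∂(volume.prod volume) := by
    rw [← G.re_inner_state_phase, smul_zero, phase_zero]
    exact (congrArg Complex.re he).trans (integral_re hi).symm
  have hre : ∀ᵐ p ∂((volume : Measure (Config N)).prod (volume : Measure (Config N))),
      (conj (α p.1) * α p.2 * G.kernel p.1 p.2).re =
        (α p.1).re * (α p.2).re * (G.kernel p.1 p.2).re := by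
    filter_upwards [hK] with p hp
    have hb1 : (α p.1).im = 0 := Complex.conj_eq_iff_im.1 (hα _)
    simp [Complex.mul_re, hb1, (Complex.lt_def.1 hp).2.symm]
  have h0 : 0 ≤ᵐ[(volume : Measure (Config N)).prod (volume : Measure (Config N))]
      fun p => (conj (α p.1) * α p.2 * G.kernel p.1 p.2).re := by
    filter_upwards [hre, hK] with p h1 hp
    rw [h1]
    exact mul_nonneg (mul_nonneg (hα0 _) (hα0 _)) (Complex.lt_def.1 hp).1.le
  rw [he']
  refine (integral_nonneg_of_ae h0).lt_of_ne fun h => ?_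
  have hz := (integral_eq_zero_iff_of_nonneg_ae h0 hi.re).1 h.symm
  obtain ⟨p, ⟨h3, h4, h5⟩, h1, h2⟩ := (Measure.dense_of_ae (hz.and (hre.and hK))).exists_mem_open
    ((Metric.isOpen_ball (x := (0 : Config N)) (ε := r)).prod
      (Metric.isOpen_ball (x := (0 : Config N)) (ε := r)))
    ⟨(0, 0), Metric.mem_ball_self hr, Metric.mem_ball_self hr⟩
  exact (mul_pos (mul_pos (hαp _ h1) (hαp _ h2)) (Complex.lt_def.1 h5).1).ne' (h4.symm.trans h3)

end ThermalData

namespace Relaxation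

variable {H : Hilb N →ₗ.[ℂ] Hilb N} {θ : ℝ} {G : ThermalData H θ} {R : Relaxation N K} {ħ : ℝ}

theorem diag_balance_of_ae_const (hħ : 0 < ħ) (hreg : R.IsRegular) (hrate : R.FiniteRates ħ G)
    (hK : ∀ᵐ p ∂((volume : Measure (Config N)).prod (volume : Measure (Config N))),
      0 < G.kernel p.1 p.2)
    (hform : ∀ α β : 𝓢(Config N, ℂ), HasCompactSupport α → HasCompactSupport β →
      R.form ħ G.state (vec α) (vec β) = 0)
    {z : Fin K → ℂ} (hz : ∀ k, ∀ᵐ ξ, R.f k ((2 * Real.pi * ħ) • ξ) = z k)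
    {α : 𝓢(Config N, ℂ)} (hc : HasCompactSupport α) (hα : ∀ ξ, conj (α ξ) = α ξ)
    (c : Config N) :
    ∑ k, ‖z k‖ ^ 2 * (orbitSum G.weight G.basis (vec α) (c + (2 * Real.pi)⁻¹ • R.κ k) -
        orbitSum G.weight G.basis (vec α) c) + (2 * Real.pi)⁻¹ * G.flow R.κaux α c = 0 := by
  rw [← diag_balance hħ hreg hrate hK hform hc hα c]
  congr 1
  refine Finset.sum_congr rfl fun k _ => ?_
  rw [G.mulBasis_of_ae_const (hrate.memLp k) (hz k), G.dissipation_of_ae_const (hz k),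
    orbitSum_const_smul, orbitSum_const_smul]
  ring

/-- A maximum principle: with constant amplitudes the balance equation is that of a jump process
with drift, for which `S` would be a stationary profile decaying at infinity. -/
theorem kicks_eq_zero (hħ : 0 < ħ) (hreg : R.IsRegular) (hrate : R.FiniteRates ħ G)
    (hK : ∀ᵐ p ∂((volume : Measure (Config N)).prod (volume : Measure (Config N))),
      0 < G.kernel p.1 p.2)
    (hform : ∀ α β : 𝓢(Config N, ℂ), HasCompactSupport α → HasCompactSupport β →
      R.form ħ G.state (vec α) (vec β) = 0)
    {z : Fin K → ℂ} (hz : ∀ k, ∀ᵐ ξ, R.f k ((2 * Real.pi * ħ) • ξ) = z k) :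
    (∀ k, z k = 0 ∨ R.κ k = 0) ∧ R.κaux = 0 := by
  obtain ⟨α, hc, hα, hα0, hαp⟩ := exists_bump (N := N) one_pos
  set S := orbitSum G.weight G.basis (vec α) with hS
  have hbal : ∀ c, ∑ k, ‖z k‖ ^ 2 * (S (c + (2 * Real.pi)⁻¹ • R.κ k) - S c) +
      (2 * Real.pi)⁻¹ * G.flow R.κaux α c = 0 :=
    fun c => diag_balance_of_ae_const hħ hreg hrate hK hform hz hc hα c
  have hcont : Continuous S := continuous_orbitSum (fun n => (G.weight_pos n).le)
    G.summable_weight_basis _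
  have htend : Tendsto S (cocompact (Config N)) (𝓝 0) :=
    tendsto_orbitSum (fun n => (G.weight_pos n).le) G.summable_weight_basis _
  have hpos : 0 < S 0 := G.orbitSum_zero_pos hK hα hα0 one_pos hαp
  obtain ⟨c, hmax⟩ := hcont.exists_forall_ge' 0
    ((htend.eventually_lt_const hpos).mono fun _ h => h.le)
  have hM : 0 < S c := hpos.trans_le (hmax 0)
  -- At a maximum the derivative along `κ_aux` vanishes and every jump term is nonpositive. Their
  -- sum is zero, so each vanishes and the kicked point is again a maximum.
  have hstep : ∀ x, S x = S c → ∀ k, z k ≠ 0 → S (x + (2 * Real.pi)⁻¹ • R.κ k) = S c := by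
    intro x hx k hk
    have hloc : IsLocalMax (fun t : ℝ => S (x + t • R.κaux)) 0 :=
      Eventually.of_forall fun t => by simpa [hx] using hmax _
    have hflow : G.flow R.κaux α x = 0 :=
      hloc.hasDerivAt_eq_zero (G.hasLineDerivAt_flow R.κaux α x)
    have h := hbal x
    rw [hflow, mul_zero, add_zero, Finset.sum_eq_zero_iff_of_nonpos fun j _ =>
      mul_nonpos_of_nonneg_of_nonpos (sq_nonneg _) (by
        rw [hx]; linarith [hmax (x + (2 * Real.pi)⁻¹ • R.κ j)])] at h
    have h1 := (mul_eq_zero.1 (h k (Finset.mem_univ k))).resolve_left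
      (pow_ne_zero 2 (norm_ne_zero_iff.2 hk))
    rw [← hx]
    exact sub_eq_zero.1 h1
  have hκ : ∀ k, z k = 0 ∨ R.κ k = 0 := by
    refine fun k => or_iff_not_imp_left.2 fun hk => ?_
    refine (smul_eq_zero.1 (eq_zero_of_const_on_line htend (c := c) hM fun j => ?_)).resolve_left
      (inv_ne_zero Real.two_pi_pos.ne')
    induction j with
    | zero => simp
    | succ j ih =>
      rw [Nat.cast_succ, add_smul, one_smul, ← add_assoc]
      exact hstep _ ih k hk
  refine ⟨hκ, ?_⟩
  have hflow : ∀ x, G.flow R.κaux α x = 0 := fun x => by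
    have h := hbal x
    rw [Finset.sum_eq_zero fun k _ => ?_, zero_add] at h
    · exact (mul_eq_zero.1 h).resolve_left (inv_ne_zero Real.two_pi_pos.ne')
    · rcases hκ k with h1 | h1 <;> simp [h1]
  -- Without jump terms the flow vanishes everywhere, so `S` keeps its positive maximum along the
  -- whole line in direction `κ_aux`.
  have hd : ∀ t : ℝ, HasDerivAt (fun t : ℝ => S (c + t • R.κaux)) 0 t := fun t => by
    have h := G.hasLineDerivAt_flow R.κaux α (c + t • R.κaux)
    rw [hflow] at h
    have h2 : HasDerivAt (fun s : ℝ => S (c + t • R.κaux + s • R.κaux)) 0 (t - t) := by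
      rw [sub_self]; exact h
    refine (h2.comp_sub_const t t).congr_of_eventuallyEq (Eventually.of_forall fun s => ?_)
    simp only []
    congr 1
    module
  refine eq_zero_of_const_on_line htend (c := c) hM fun j => ?_
  have := is_const_of_deriv_eq_zero (fun t => (hd t).differentiableAt) (fun t => (hd t).deriv) j 0
  simpa using this

end Relaxation

/-! ### Constant amplitudes -/

section

variable {ħ : ℝ} {κ : Config N}

theorem jumpOp_of_ae_const {f : Config N → ℂ} {z : ℂ}
    (hf : ∀ᵐ ξ, f ((2 * Real.pi * ħ) • ξ) = z) (hz : z = 0 ∨ κ = 0) (φ : Hilb N) :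
    φ ∈ (jumpOp ħ κ f).domain ∧ app (jumpOp ħ κ f) φ = z • φ ∧
      φ ∈ (jumpOp ħ κ f)†.domain ∧ app (jumpOp ħ κ f)† φ = conj z • φ := by
  have hmem := memLp_const_mul hf (FT φ)
  have hconj : ∀ᵐ ξ, conj (f ((2 * Real.pi * ħ) • ξ)) = conj z := hf.mono fun ξ h => by rw [h]
  have hc : MulCompact fun ξ => f ((2 * Real.pi * ħ) • ξ) := fun u hu hu' => by
    refine ((hu.memLp_of_hasCompactSupport (p := 2) hu').const_mul z).ae_eq ?_
    filter_upwards [hf] with ξ h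
    rw [h]
  obtain ⟨h1, h2⟩ := adjoint_jumpOp (κ := κ) hc φ (memLp_const_mul hconj _)
  refine ⟨mem_jumpOp.2 hmem, ?_, h1, ?_⟩
  · rw [app_jumpOp hmem, toLp_const_mul hf, map_smul, LinearIsometryEquiv.symm_apply_apply,
      map_smul]
    rcases hz with h | h <;> simp [h, phase_zero]
  · rw [h2, toLp_const_mul hconj, map_smul, LinearIsometryEquiv.symm_apply_apply]
    rcases hz with h | h <;> simp [h, phase_zero]

theorem dissForm_jumpOp_of_ae_const {f : Config N → ℂ} {z : ℂ}
    (hf : ∀ᵐ ξ, f ((2 * Real.pi * ħ) • ξ) = z) (hz : z = 0 ∨ κ = 0)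
    (ρ : Hilb N →L[ℂ] Hilb N) (φ ψ : Hilb N) : dissForm (jumpOp ħ κ f) ρ φ ψ = 0 := by
  have h := jumpOp_of_ae_const (κ := κ) hf hz
  rw [dissForm, (h φ).2.1, (h ψ).2.1, (h φ).2.2.2, (h ψ).2.2.2, (h (z • φ)).2.2.2,
    (h (z • ψ)).2.2.2]
  simp only [map_smul, inner_smul_left, inner_smul_right, Complex.conj_conj]
  ring

theorem driftOp_zero_of_ae_const {g : Config N → ℝ} {d : ℝ}
    (hg : ∀ᵐ ξ, g ((2 * Real.pi * ħ) • ξ) = d) (φ : Hilb N) :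
    φ ∈ (driftOp ħ 0 g).domain ∧ app (driftOp ħ 0 g) φ = (d : ℂ) • φ := by
  have h0 : ∀ᵐ x : Config N, ((inner ℝ (0 : Config N) x : ℝ) : ℂ) = 0 :=
    Eventually.of_forall fun x => by simp
  have hg' : ∀ᵐ ξ, (g ((2 * Real.pi * ħ) • ξ) : ℂ) = d := hg.mono fun ξ h => by rw [h]
  have m1 : φ ∈ (mulOp fun x : Config N => ((inner ℝ (0 : Config N) x : ℝ) : ℂ)).domain :=
    memLp_const_mul h0 φ
  have m2 : φ ∈ (momOp ħ fun p => (g p : ℂ)).domain :=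
    mem_momOp.2 (memLp_const_mul hg' (FT φ))
  refine ⟨⟨m1, m2⟩, ?_⟩
  rw [driftOp, app_add m1 m2, app_mulOp (memLp_const_mul h0 φ), toLp_const_mul h0, zero_smul,
    zero_add, app_momOp (memLp_const_mul hg' (FT φ)), toLp_const_mul hg', map_smul,
    LinearIsometryEquiv.symm_apply_apply]

theorem app_driftOp_zero {g : Config N → ℝ} {β : 𝓢(Config N, ℂ)}
    (hm : MemLp (fun ξ => (g ((2 * Real.pi * ħ) • ξ) : ℂ) * β ξ) 2 volume) :
    app (driftOp ħ 0 g) (vec β) = FT.symm (hm.toLp _) := by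
  rw [app_driftOp 0 hm, add_eq_right]
  refine Lp.ext ?_
  filter_upwards [position_toLp_ae 0 (𝓕⁻ β), Lp.coeFn_zero ℂ 2 (volume : Measure (Config N))]
    with x h1 h2
  rw [h1, h2]
  simp

end

/-! ### Functions of the momentum that commute with the thermal state -/

namespace ThermalData

variable {H : Hilb N →ₗ.[ℂ] Hilb N} {θ : ℝ} (G : ThermalData H θ)

/-- Commutation with the thermal state extends from test functions to all of `L²` in one of the
arguments. -/
theorem mul_FT_state_ae {b : Config N → ℝ}
    (hb : ∀ S : Set (Config N), IsCompact S → MemLp (fun ξ => (b ξ : ℂ)) 2 (volume.restrict S))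
    {α : 𝓢(Config N, ℂ)} (m : MemLp (fun ξ => (b ξ : ℂ) * α ξ) 2 volume)
    (hcomm : ∀ s : 𝓢(Config N, ℂ), HasCompactSupport s →
      ∀ ms : MemLp (fun ξ => (b ξ : ℂ) * s ξ) 2 volume,
      inner ℂ (FT.symm (ms.toLp _)) (G.state (vec α)) =
        inner ℂ (vec s) (G.state (FT.symm (m.toLp _)))) :
    (fun ξ => (b ξ : ℂ) * FT (G.state (vec α)) ξ) =ᵐ[volume]
      FT (G.state (FT.symm (m.toLp _))) := by
  refine ae_eq_of_schwartz ?_ ((Lp.memLp _).locallyIntegrable (by norm_num)) fun s hs hs' => ?_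
  · rw [locallyIntegrable_iff]
    exact fun S hS => MemLp.integrable_mul (p := 2) (q := 2) (hb S hS) ((Lp.memLp _).restrict S)
  · have ms := memLp_mul_of_loc hb s.continuous hs
    have h := hcomm s hs ms
    have h2 : inner ℂ (vec s) (G.state (FT.symm (m.toLp _))) =
        ∫ ξ, conj (s ξ) * FT (G.state (FT.symm (m.toLp _))) ξ :=
      inner_FT_symm_toLp (s.memLp 2 volume) _
    rw [inner_FT_symm_toLp, h2] at h
    simp only [map_mul, Complex.conj_ofReal, hs'] at h
    rw [← h]
    exact integral_congr_ae (Eventually.of_forall fun ξ => by ring)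

theorem abs_arctan_le_pi_div_two (x : ℝ) : |Real.arctan x| ≤ Real.pi / 2 :=
  abs_le.2 ⟨(Real.neg_pi_div_two_lt_arctan x).le, (Real.arctan_lt_pi_div_two x).le⟩

/-- Formally `(b(ξ) - b(η)) r(ξ, η) = 0`. Weighting with `b(ξ) - b(η)` would call for `b²` in
`L²_loc`, while only `b` is; the bounded, strictly increasing `arctan b` replaces it. -/
theorem ae_const_of_commute
    (hK : ∀ᵐ p ∂((volume : Measure (Config N)).prod (volume : Measure (Config N))),
      0 < G.kernel p.1 p.2) {b : Config N → ℝ}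
    (hb : ∀ S : Set (Config N), IsCompact S → MemLp (fun ξ => (b ξ : ℂ)) 2 (volume.restrict S))
    (hcomm : ∀ s t : 𝓢(Config N, ℂ), HasCompactSupport s → HasCompactSupport t →
      ∀ (ms : MemLp (fun ξ => (b ξ : ℂ) * s ξ) 2 volume)
        (mt : MemLp (fun ξ => (b ξ : ℂ) * t ξ) 2 volume),
      inner ℂ (FT.symm (ms.toLp _)) (G.state (vec t)) =
        inner ℂ (vec s) (G.state (FT.symm (mt.toLp _)))) :
    ∃ d, ∀ᵐ ξ, b ξ = d := by
  refine ae_const_of_ball fun r hr => ?_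
  obtain ⟨α, hc, hα, hα0, hαp⟩ := exists_bump (N := N) hr
  have hbt : ∀ S : Set (Config N), IsCompact S →
      MemLp (fun ξ => (Real.arctan (b ξ) : ℂ)) 2 (volume.restrict S) := fun S hS => by
    have : IsFiniteMeasure (volume.restrict S) := ⟨by
      rw [Measure.restrict_apply_univ]; exact hS.measure_lt_top⟩
    refine MemLp.of_bound (C := Real.pi / 2) ?_ (Eventually.of_forall fun ξ => ?_)
    · have hcont : Continuous fun w : ℂ => (Real.arctan w.re : ℂ) :=
        Complex.continuous_ofReal.comp (Real.continuous_arctan.comp Complex.continuous_re)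
      exact hcont.comp_aestronglyMeasurable (hb S hS).aestronglyMeasurable
    · rw [Complex.norm_real]
      exact abs_arctan_le_pi_div_two _
  have hbb : ∀ S : Set (Config N), IsCompact S →
      MemLp (fun ξ => (b ξ : ℂ) * (Real.arctan (b ξ) : ℂ)) 2 (volume.restrict S) := fun S hS => by
    refine MemLp.of_le_mul (c := Real.pi / 2) (hb S hS)
      ((hb S hS).aestronglyMeasurable.mul (hbt S hS).aestronglyMeasurable)
      (Eventually.of_forall fun ξ => ?_)
    rw [norm_mul, mul_comm, Complex.norm_real (Real.arctan _)]
    exact mul_le_mul_of_nonneg_right (abs_arctan_le_pi_div_two _) (norm_nonneg _)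
  have m1 := memLp_mul_of_loc hb α.continuous hc
  have m2 := memLp_mul_of_loc hbt α.continuous hc
  have m3 := memLp_mul_of_loc hbb α.continuous hc
  -- The vector with momentum function `arctan(b) α` need not be smooth; `mul_FT_state_ae` extends
  -- the commutation to it.
  have heq : inner ℂ (FT.symm (m3.toLp _)) (G.state (vec α)) =
      inner ℂ (FT.symm (m2.toLp _)) (G.state (FT.symm (m1.toLp _))) := by
    rw [inner_FT_symm_toLp, inner_FT_symm_toLp]
    refine integral_congr_ae ?_
    filter_upwards [G.mul_FT_state_ae hb m1 fun s hs ms => hcomm s α hs hc ms m1] with ξ h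
    rw [← h]
    simp only [map_mul, Complex.conj_ofReal]
    ring
  obtain ⟨i1, e1⟩ := G.inner_vec_state m3 α
  obtain ⟨i2, e2⟩ := G.inner_state_eq_integral m2 m1
  set F : Config N × Config N → ℂ := fun p =>
    conj ((b p.1 : ℂ) * (Real.arctan (b p.1) : ℂ) * α p.1) * α p.2 * G.kernel p.1 p.2 -
      conj ((Real.arctan (b p.1) : ℂ) * α p.1) * ((b p.2 : ℂ) * α p.2) * G.kernel p.1 p.2 with hF
  have hFi : Integrable F (volume.prod volume) := i1.sub i2
  have hF0 : ∫ p, F p ∂(volume.prod volume) = 0 := by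
    rw [hF, integral_sub i1 i2, ← e1, ← e2, heq, sub_self]
  -- Symmetrising under `ξ ↔ η` turns `arctan(b₁)(b₁ - b₂)` into `(b₁ - b₂)(arctan b₁ - arctan b₂)`,
  -- which is nonnegative and vanishes only if `b₁ = b₂`.
  have hFs : Integrable (fun p => F p.swap) (volume.prod volume) := hFi.swap
  have hEi : Integrable (fun p => F p + F p.swap) (volume.prod volume) := hFi.add hFs
  have hE0 : ∫ p, (F p + F p.swap).re ∂(volume.prod volume) = 0 := by
    have h : ∫ p, (F p + F p.swap).re ∂(volume.prod volume) =
        (∫ p, (F p + F p.swap) ∂(volume.prod volume)).re := integral_re hEi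
    rw [h, integral_add hFi hFs, integral_prod_swap, hF0, add_zero, Complex.zero_re]
  have hre : ∀ᵐ p ∂((volume : Measure (Config N)).prod (volume : Measure (Config N))),
      (F p + F p.swap).re = (b p.1 - b p.2) * (Real.arctan (b p.1) - Real.arctan (b p.2)) *
        ((α p.1).re * (α p.2).re * (G.kernel p.1 p.2).re) := by
    filter_upwards [hK] with p hp
    have hk : (G.kernel p.1 p.2).im = 0 := (Complex.lt_def.1 hp).2.symm
    have hb1 : (α p.1).im = 0 := Complex.conj_eq_iff_im.1 (hα _)
    have hb2 : (α p.2).im = 0 := Complex.conj_eq_iff_im.1 (hα _)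
    simp only [hF, Prod.fst_swap, Prod.snd_swap, ← G.conj_kernel p.1 p.2]
    simp only [Complex.add_re, Complex.sub_re, Complex.mul_re, Complex.mul_im, map_mul,
      Complex.conj_ofReal, Complex.conj_re, Complex.conj_im, Complex.ofReal_re, Complex.ofReal_im,
      hk, hb1, hb2]
    ring
  have hmono : ∀ x y : ℝ, 0 ≤ (x - y) * (Real.arctan x - Real.arctan y) := fun x y => by
    rcases le_total x y with h | h
    · exact mul_nonneg_of_nonpos_of_nonpos (sub_nonpos.2 h)
        (sub_nonpos.2 (Real.arctan_strictMono.monotone h))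
    · exact mul_nonneg (sub_nonneg.2 h) (sub_nonneg.2 (Real.arctan_strictMono.monotone h))
  have hE : 0 ≤ᵐ[(volume : Measure (Config N)).prod (volume : Measure (Config N))]
      fun p => (F p + F p.swap).re := by
    filter_upwards [hre, hK] with p h hp
    rw [h]
    exact mul_nonneg (hmono _ _) (mul_nonneg (mul_nonneg (hα0 _) (hα0 _))
      (Complex.lt_def.1 hp).1.le)
  filter_upwards [(integral_eq_zero_iff_of_nonneg_ae hE hEi.re).1 hE0, hre, hK]
    with p h1 h2 h3 h4 h5
  rcases mul_eq_zero.1 (h2.symm.trans h1) with h | h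
  · rcases mul_eq_zero.1 h with h | h
    · exact sub_eq_zero.1 h
    · exact Real.arctan_injective (sub_eq_zero.1 h)
  · exact absurd h (mul_pos (mul_pos (hαp _ h4) (hαp _ h5)) (Complex.lt_def.1 h3).1).ne'

end ThermalData

namespace Relaxation

variable {H : Hilb N →ₗ.[ℂ] Hilb N} {θ : ℝ} {G : ThermalData H θ} {R : Relaxation N K} {ħ : ℝ}

/-- `R` is trivial: its jump operators and its drift are multiples of the identity. -/
structure IsTrivial (R : Relaxation N K) (ħ : ℝ) : Prop where
  jump : ∀ k, ∃ z : ℂ, (∀ᵐ ξ, R.f k ((2 * Real.pi * ħ) • ξ) = z) ∧ (z = 0 ∨ R.κ k = 0)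
  force : R.κaux = 0
  drift : ∃ d : ℝ, ∀ᵐ ξ, R.faux ((2 * Real.pi * ħ) • ξ) = d

theorem IsTrivial.mem_domain (h : R.IsTrivial ħ) (φ : Hilb N) : φ ∈ R.domain ħ := by
  refine ⟨?_, fun k => ?_⟩
  · obtain ⟨d, hd⟩ := h.drift
    rw [Relaxation.drift, h.force]
    exact (driftOp_zero_of_ae_const hd φ).1
  · obtain ⟨z, hz, hκ⟩ := h.jump k
    have hA := jumpOp_of_ae_const hz hκ
    exact ⟨(hA φ).2.2.1, (hA φ).1, (hA _).2.2.1⟩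

theorem IsTrivial.form_eq_zero (h : R.IsTrivial ħ) (ρ : Hilb N →L[ℂ] Hilb N) (φ ψ : Hilb N) :
    R.form ħ ρ φ ψ = 0 := by
  obtain ⟨d, hd⟩ := h.drift
  rw [form, Finset.sum_eq_zero fun k _ => ?_, commForm, Relaxation.drift, h.force,
    (driftOp_zero_of_ae_const hd φ).2, (driftOp_zero_of_ae_const hd ψ).2, map_smul,
    inner_smul_left, inner_smul_right, Complex.conj_ofReal, sub_self, mul_zero, sub_zero]
  obtain ⟨z, hz, hκ⟩ := h.jump k
  exact dissForm_jumpOp_of_ae_const hz hκ ρ φ ψ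

/-- A relaxation superoperator that leaves the thermal state stationary is trivial. -/
theorem isTrivial_of_stationary (hħ : 0 < ħ) (hreg : R.IsRegular) (hrate : R.FiniteRates ħ G)
    (hK : ∀ᵐ p ∂((volume : Measure (Config N)).prod (volume : Measure (Config N))),
      0 < G.kernel p.1 p.2)
    (hform : ∀ α β : 𝓢(Config N, ℂ), HasCompactSupport α → HasCompactSupport β →
      R.form ħ G.state (vec α) (vec β) = 0) : R.IsTrivial ħ := by
  choose z hz using ae_const_f hħ hreg hrate hK hform
  obtain ⟨hκ, hforce⟩ := kicks_eq_zero hħ hreg hrate hK hform hz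
  refine ⟨fun k => ⟨z k, hz k, hκ k⟩, hforce,
    G.ae_const_of_commute hK (hreg.faux_scaled hħ) fun s t hs ht ms mt => ?_⟩
  have h := hform s t hs ht
  have hdiss : ∀ k, dissForm (R.A ħ k) G.state (vec s) (vec t) = 0 := fun k =>
    dissForm_jumpOp_of_ae_const (hz k) (hκ k) _ _ _
  rw [form, Finset.sum_eq_zero fun k _ => hdiss k, zero_sub, neg_eq_zero,
    mul_eq_zero_iff_left Complex.I_ne_zero, commForm, Relaxation.drift,
    hforce, app_driftOp_zero ms, app_driftOp_zero mt] at h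
  exact sub_eq_zero.1 h

end Relaxation

/-! ### Unitary evolution does not converge -/

/-- A convergent solution of `y' = iνy` is constant. -/
theorem eq_limit_of_hasDeriv_I_mul {y : ℝ → ℂ} {L : ℂ} {ν : ℝ}
    (hy : ∀ t, 0 ≤ t → HasDerivWithinAt y (Complex.I * ν * y t) (Ici 0) t)
    (hL : Tendsto y atTop (𝓝 L)) : y 0 = L := by
  have h0 : Complex.I * ν * L = 0 := eq_zero_of_tendsto_deriv hy hL (hL.const_mul _)
  have hd : ∀ t ∈ Ici (0 : ℝ), HasDerivWithinAt (fun t : ℝ =>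
      Complex.exp (-(Complex.I * ν) * (t : ℂ)) * y t) 0 (Ici 0) t := fun t ht => by
    have he : HasDerivAt (fun t : ℝ => Complex.exp (-(Complex.I * ν) * (t : ℂ)))
        (Complex.exp (-(Complex.I * ν) * (t : ℂ)) * (-(Complex.I * ν) * 1)) t :=
      (((hasDerivAt_id (t : ℂ)).const_mul _).cexp).comp_ofReal
    exact (he.hasDerivWithinAt.mul (hy t ht)).congr_deriv (by ring)
  have hconst : ∀ t : ℝ, 0 ≤ t →
      Complex.exp (-(Complex.I * ν) * (t : ℂ)) * y t = y 0 := fun t ht => by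
    have := (convex_Ici (0 : ℝ)).norm_image_sub_le_of_norm_hasDerivWithin_le (C := 0) hd
      (fun _ _ => by simp) (mem_Ici.2 le_rfl) (mem_Ici.2 ht)
    rw [zero_mul, norm_le_zero_iff, sub_eq_zero] at this
    simpa using this
  -- Either `ν = 0` and `y` is constant, or `L = 0`; in the latter case the constant modulus `|y|`
  -- must be zero.
  rcases mul_eq_zero.1 h0 with h | h
  · refine tendsto_nhds_unique (tendsto_const_nhds.congr' ?_) hL
    filter_upwards [eventually_ge_atTop 0] with t ht
    simpa [h] using (hconst t ht).symm
  · rw [h] at hL ⊢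
    refine norm_eq_zero.1 (tendsto_nhds_unique (tendsto_const_nhds.congr' ?_)
      (hL.norm.trans (by rw [norm_zero])))
    filter_upwards [eventually_ge_atTop 0] with t ht
    rw [← hconst t ht, norm_mul, Complex.norm_exp]
    simp

theorem ThermalData.ext_basis {H : Hilb N →ₗ.[ℂ] Hilb N} {θ : ℝ} (G : ThermalData H θ)
    {S T : Hilb N →L[ℂ] Hilb N}
    (h : ∀ n m, inner ℂ (G.basis n) (S (G.basis m)) = inner ℂ (G.basis n) (T (G.basis m))) :
    S = T := by
  refine ContinuousLinearMap.ext_on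
    (Submodule.dense_iff_topologicalClosure_eq_top.2 G.basis.dense_span) ?_
  rintro _ ⟨m, rfl⟩
  refine G.basis.repr.injective (lp.ext (funext fun n => ?_))
  rw [HilbertBasis.repr_apply_apply, HilbertBasis.repr_apply_apply, h]

/-- For trivial `R` the energy eigenvectors are test vectors, and the matrix element between `ψₙ`
and `ψₘ` oscillates at the frequency `(Eₘ - Eₙ)/ħ`. Its convergence fixes its initial value. -/
theorem Relaxation.IsTrivial.initial_eq {H : Hilb N →ₗ.[ℂ] Hilb N} {θ ħ : ℝ}
    {R : Relaxation N K} (hR : R.IsTrivial ħ) (G : ThermalData H θ)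
    {ρ : ℝ → Hilb N →L[ℂ] Hilb N} (hρ : R.IsTrajectory ħ H ρ) (hc : ConvergesTo ρ G.state) :
    ρ 0 = G.state := by
  refine G.ext_basis fun n m => ?_
  refine eq_limit_of_hasDeriv_I_mul (y := fun t => inner ℂ (G.basis n) (ρ t (G.basis m)))
    (ν := (G.energy m - G.energy n) / ħ) (fun t ht => ?_) (hc _ _)
  refine (hρ.master _ ⟨G.mem_domain n, hR.mem_domain _⟩ _ ⟨G.mem_domain m, hR.mem_domain _⟩ t
    ht).congr_deriv ?_
  rw [hR.form_eq_zero, commForm, G.eigen, G.eigen, map_smul, inner_smul_left, inner_smul_right,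
    Complex.conj_ofReal]
  push_cast
  ring

end NoThermalization

end

/-! ### Conclusion: convergence forces a trivial relaxation. -/

open NoThermalization in
theorem theorem2 {N K : ℕ} (ħ θ : ℝ) (hħ : 0 < ħ) (hθ : 0 < θ)
    (m : Fin N → ℝ) (hm : ∀ n, 0 < m n) (U : Config N → ℝ)
    (H : Hilb N →ₗ.[ℂ] Hilb N) (hH : IsHamiltonian ħ m U H)
    (G : ThermalData H θ)
    (hpos : ∀ p l : Config N, 0 < blokhintsev ħ G p l)
    (heven : ∀ p l : Config N, blokhintsev ħ G p (-l) = blokhintsev ħ G p l)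
    (hmax : ∀ p l : Config N, p ≠ 0 → l ≠ 0 → blokhintsev ħ G p l < blokhintsev ħ G 0 0)
    (R : Relaxation N K) (hreg : R.IsRegular) (hcore : R.HasCommonCore ħ H)
    (hrate : R.FiniteRates ħ G) :
    (¬ R.IsZero ħ → ∀ ρ, R.IsTrajectory ħ H ρ → ¬ ConvergesTo ρ G.state) ∧
    (∀ ρ, R.IsTrajectory ħ H ρ → ρ 0 ≠ G.state → ¬ ConvergesTo ρ G.state) := by
  have hK := G.kernel_pos hħ hpos
  have key : ∀ ρ, R.IsTrajectory ħ H ρ → ConvergesTo ρ G.state → R.IsTrivial ħ := fun ρ hρ hc =>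
    Relaxation.isTrivial_of_stationary hħ hreg hrate hK
      (Relaxation.form_vec_of_testVectors hcore fun _ hφ _ hψ =>
        Relaxation.form_state_of_tendsto G hH.selfAdjoint hρ hc hφ hψ)
  exact ⟨fun hR ρ hρ hc => hR fun σ _ φ _ ψ _ => (key ρ hρ hc).form_eq_zero σ φ ψ,
    fun ρ hρ h0 hc => h0 ((key ρ hρ hc).initial_eq G hρ hc)⟩
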